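/- Let $\mathbf{k}$ be an algebraically closed field of characteristic $p>0$, and let $\mathfrak g$ be a restricted Lie algebra over $\mathbf{k}$, with $p$-map $x\mapsto x^{[p]}$ and with a finite basis $x_1,\dots,x_n$. Let $u(\mathfrak g)$ be the restricted universal enveloping algebra of $\mathfrak g$, i.e. the quotient of the universal enveloping algebra $\mathcal U(\mathfrak g)$ by the two-sided ideal generated by all $x^p-x^{[p]}$ with $x\in\mathfrak g$, with the comultiplication $\Delta$ that is the algebra map satisfying $\Delta(x)=x\otimes 1+1\otimes x$ for $x\in\mathfrak g$. For a Hopf algebra $H$ over $\mathbf k$, let $$\mathrm H^2(\mathbf{k},H)=\operatorname{Ker}d^2/\operatorname{Im}d^1$$ be the second Hochschild cohomology of the coalgebra $H$ with coefficients in the trivial bicomodule $\mathbf{k}$, computed by the cobar construction, where $d^1:H\to H^{\otimes 2}$ and $d^2:H^{\otimes 2}\to H^{\otimes 3}$ are $$d^1=1\otimes I-\Delta+I\otimes 1,\qquad d^2=1\otimes I\otimes I-\Delta\otimes I+I\otimes\Delta-I\otimes I\otimes 1.$$ For $x\in\mathfrak g$ put $$\omega(x)=\sum_{i=1}^{p-1}\frac{(p-1)!}{i!\,(p-i)!}\,x^i\otimes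 x^{p-i}\in u(\mathfrak g)\otimes u(\mathfrak g).$$ Then the elements $\omega(x_i)$ $(1\le i\le n)$ and $x_j\otimes x_k$ $(1\le j<k\le n)$ of $u(\mathfrak g)\otimes u(\mathfrak g)$ lie in $\operatorname{Ker}d^2$, and their classes form a basis of the $\mathbf{k}$-vector space $\mathrm H^2(\mathbf{k},u(\mathfrak g))$. In particular $\dim_{\mathbf{k}}\mathrm H^2(\mathbf{k},u(\mathfrak g))=n(n+1)/2$. -/

import Mathlib

open scoped TensorProduct

noncomputable section

/-! ### Restricted Lie algebras -/

/-- The coefficient of `λ ^ i` in `x (ad (λ x + y)) ^ m`, where `ad z` acts on the right, that is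
`u (ad z) = ⁅u, z⁆`. The recursion multiplies out
`x (ad (λ x + y)) ^ (m + 1) = λ ⁅x (ad (λ x + y)) ^ m, x⁆ + ⁅x (ad (λ x + y)) ^ m, y⁆`. -/
def adPowCoeff {g : Type*} [LieRing g] (x y : g) : ℕ → ℕ → g
  | 0, 0 => x
  | 0, _ + 1 => 0
  | m + 1, 0 => ⁅adPowCoeff x y m 0, y⁆
  | m + 1, i + 1 => ⁅adPowCoeff x y m i, x⁆ + ⁅adPowCoeff x y m (i + 1), y⁆

/-- The Lie polynomial `s_i(x, y)`: `i s_i(x, y)` is the coefficient of `λ ^ (i - 1)` in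
`x (ad (λ x + y)) ^ (p - 1)`. It is used for `1 ≤ i ≤ p - 1` in characteristic `p` only. -/
def jacobsonPoly (p : ℕ) (k : Type*) {g : Type*} [Field k] [LieRing g] [LieAlgebra k g]
    (i : ℕ) (x y : g) : g :=
  (i : k)⁻¹ • adPowCoeff x y (p - 1) (i - 1)

/-- A restricted Lie algebra over `k` (which will have characteristic `p`): a Lie algebra with a
`p`-map `x ↦ x^[p]` subject to Jacobson's axioms. -/
class RestrictedLieAlgebra (p : ℕ) (k : Type*) (g : Type*) [Field k] [LieRing g]
    [LieAlgebra k g] where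
  /-- The `p`-map `x ↦ x^[p]`. -/
  pMap : g → g
  pMap_smul : ∀ (a : k) (x : g), pMap (a • x) = a ^ p • pMap x
  pMap_add : ∀ x y : g,
    pMap (x + y) = pMap x + pMap y + ∑ i ∈ Finset.Icc 1 (p - 1), jacobsonPoly p k i x y
  /-- `[x, y^[p]] = x (ad y) ^ p`. -/
  lie_pMap : ∀ x y : g, ⁅x, pMap y⁆ = (fun u => ⁅u, y⁆)^[p] x

/-- `adPowCoeff x y m` lists the coefficients of `x (ad (λ x + y)) ^ m`. -/
theorem sum_adPowCoeff {k : Type*} {g : Type*} [Field k] [LieRing g] [LieAlgebra k g]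
    (x y : g) (m : ℕ) (t : k) :
    ∑ i ∈ Finset.range (m + 1), t ^ i • adPowCoeff x y m i =
      (fun u => ⁅u, t • x + y⁆)^[m] x := by
  have hz : ∀ m i, m < i → adPowCoeff x y m i = 0 := by
    intro m
    induction m with
    | zero => intro i hi; obtain ⟨j, rfl⟩ := Nat.exists_eq_succ_of_ne_zero hi.ne'; rfl
    | succ m ih =>
      intro i hi
      obtain ⟨j, rfl⟩ := Nat.exists_eq_succ_of_ne_zero (Nat.ne_of_gt (Nat.zero_lt_of_lt hi))
      simp only [adPowCoeff]
      rw [ih j (by omega), ih (j + 1) (by omega)]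
      simp
  induction m with
  | zero => simp [adPowCoeff]
  | succ m ih =>
    rw [Function.iterate_succ_apply', ← ih, Finset.sum_range_succ']
    have h2 : ∑ i ∈ Finset.range (m + 1), t ^ i • ⁅adPowCoeff x y m i, y⁆ =
        ∑ i ∈ Finset.range (m + 1), t ^ (i + 1) • ⁅adPowCoeff x y m (i + 1), y⁆ +
          t ^ 0 • ⁅adPowCoeff x y m 0, y⁆ := by
      rw [← Finset.sum_range_succ' (fun i => t ^ i • ⁅adPowCoeff x y m i, y⁆),
        Finset.sum_range_succ _ (m + 1), hz m (m + 1) (by omega)]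
      simp
    simp only [adPowCoeff, lie_add, lie_smul, sum_lie, smul_lie, smul_add,
      Finset.sum_add_distrib]
    rw [h2, Finset.smul_sum, add_assoc]
    congr 1
    refine Finset.sum_congr rfl fun i _ => ?_
    rw [smul_smul, pow_succ']

/-! ### The restricted universal enveloping algebra -/

section Enveloping

attribute [local instance 100] LieRing.ofAssociativeRing

variable (p : ℕ) (k : Type*) (g : Type*) [Field k] [LieRing g] [LieAlgebra k g]
  [RestrictedLieAlgebra p k g]

/-- The relations `x ^ p = x^[p]`, for `x` in `g`, in the universal enveloping algebra of `g`. -/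
inductive RestrictedEnvelopingRel :
    UniversalEnvelopingAlgebra k g → UniversalEnvelopingAlgebra k g → Prop
  | pow_compat (x : g) : RestrictedEnvelopingRel (UniversalEnvelopingAlgebra.ι k x ^ p)
      (UniversalEnvelopingAlgebra.ι k (RestrictedLieAlgebra.pMap p k x))

/-- The restricted universal enveloping algebra `u(g)`: the quotient of the universal enveloping
algebra by the two-sided ideal generated by all `x ^ p - x^[p]` with `x` in `g`. -/
def RestrictedEnvelopingAlgebra : Type _ := RingQuot (RestrictedEnvelopingRel p k g)

namespace RestrictedEnvelopingAlgebra

instance : Ring (RestrictedEnvelopingAlgebra p k g) :=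
  inferInstanceAs (Ring (RingQuot (RestrictedEnvelopingRel p k g)))

instance : Algebra k (RestrictedEnvelopingAlgebra p k g) :=
  inferInstanceAs (Algebra k (RingQuot (RestrictedEnvelopingRel p k g)))

/-- The quotient map from the universal enveloping algebra. -/
def mkAlgHom : UniversalEnvelopingAlgebra k g →ₐ[k] RestrictedEnvelopingAlgebra p k g :=
  RingQuot.mkAlgHom k (RestrictedEnvelopingRel p k g)

variable {g}

/-- The canonical map from `g` to `u(g)`. -/
def ι : g →ₗ⁅k⁆ RestrictedEnvelopingAlgebra p k g :=
  (mkAlgHom p k g : UniversalEnvelopingAlgebra k g →ₗ⁅k⁆ RestrictedEnvelopingAlgebra p k g).comp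
    (UniversalEnvelopingAlgebra.ι k)

theorem ι_pow (x : g) : ι p k x ^ p = ι p k (RestrictedLieAlgebra.pMap p k x) := by
  have h := RingQuot.mkAlgHom_rel k (RestrictedEnvelopingRel.pow_compat (p := p) (k := k) x)
  rw [map_pow] at h
  exact h

/-- A Lie algebra morphism `f` to an associative algebra with `f x ^ p = f x^[p]` extends to
`u(g)`. -/
def lift {A : Type*} [Ring A] [Algebra k A] (f : g →ₗ⁅k⁆ A)
    (hf : ∀ x, f x ^ p = f (RestrictedLieAlgebra.pMap p k x)) :
    RestrictedEnvelopingAlgebra p k g →ₐ[k] A :=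
  RingQuot.liftAlgHom k ⟨UniversalEnvelopingAlgebra.lift k f, by
    rintro _ _ ⟨x⟩
    rw [map_pow, UniversalEnvelopingAlgebra.lift_ι_apply, UniversalEnvelopingAlgebra.lift_ι_apply,
      hf]⟩

@[simp]
theorem lift_ι {A : Type*} [Ring A] [Algebra k A] (f : g →ₗ⁅k⁆ A)
    (hf : ∀ x, f x ^ p = f (RestrictedLieAlgebra.pMap p k x)) (x : g) :
    lift p k f hf (ι p k x) = f x := by
  refine (RingQuot.liftAlgHom_mkAlgHom_apply k _ _ _).trans ?_
  exact UniversalEnvelopingAlgebra.lift_ι_apply k f x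

variable {p k} in
theorem hom_ext {A : Type*} [Ring A] [Algebra k A]
    {f₁ f₂ : RestrictedEnvelopingAlgebra p k g →ₐ[k] A}
    (h : ∀ x : g, f₁ (ι p k x) = f₂ (ι p k x)) : f₁ = f₂ := by
  refine RingQuot.ringQuot_ext' k f₁ f₂ ?_
  apply UniversalEnvelopingAlgebra.hom_ext
  ext x
  exact h x

variable [Fact p.Prime]

variable (g) in
/-- The counit of `u(g)`: it vanishes on `g`. -/
def counitHom : RestrictedEnvelopingAlgebra p k g →ₐ[k] k :=
  lift p k (0 : g →ₗ⁅k⁆ k) (fun _ => by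
    simp [(Fact.out : p.Prime).ne_zero])

@[simp]
theorem counitHom_ι (x : g) : counitHom p k g (ι p k x) = 0 := by simp [counitHom]

/-- The primitive element `x ⊗ 1 + 1 ⊗ x` attached to `x` in `g`. -/
def primitiveHom : g →ₗ⁅k⁆
    (RestrictedEnvelopingAlgebra p k g ⊗[k] RestrictedEnvelopingAlgebra p k g) :=
  { toFun := fun x => ι p k x ⊗ₜ 1 + 1 ⊗ₜ ι p k x
    map_add' := fun x y => by
      rw [map_add, TensorProduct.add_tmul, TensorProduct.tmul_add]; abel
    map_smul' := fun a x => by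
      rw [map_smul, ← TensorProduct.smul_tmul', TensorProduct.tmul_smul, RingHom.id_apply,
        smul_add]
    map_lie' := fun {x y} => by
      simp only [LieHom.map_lie, LieRing.of_associative_ring_bracket, TensorProduct.sub_tmul,
        TensorProduct.tmul_sub, mul_add, add_mul, Algebra.TensorProduct.tmul_mul_tmul, one_mul,
        mul_one]
      abel }

variable [CharP k p]

variable (g) in
/-- The comultiplication of `u(g)`: the algebra map for which every `x` in `g` is primitive. -/
def comulHom : RestrictedEnvelopingAlgebra p k g →ₐ[k]
    (RestrictedEnvelopingAlgebra p k g ⊗[k] RestrictedEnvelopingAlgebra p k g) :=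
  lift p k (primitiveHom p k) (fun x => by
    have : Nontrivial (RestrictedEnvelopingAlgebra p k g) :=
      (counitHom p k g).toRingHom.domain_nontrivial
    have : CharP (RestrictedEnvelopingAlgebra p k g ⊗[k] RestrictedEnvelopingAlgebra p k g) p :=
      charP_of_injective_algebraMap (algebraMap k _).injective p
    change (ι p k x ⊗ₜ 1 + 1 ⊗ₜ ι p k x) ^ p =
      ι p k (RestrictedLieAlgebra.pMap p k x) ⊗ₜ 1 + 1 ⊗ₜ ι p k (RestrictedLieAlgebra.pMap p k x)
    rw [add_pow_char_of_commute]
    · simp [Algebra.TensorProduct.tmul_pow, ι_pow]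
    · simp [Commute, SemiconjBy])

@[simp]
theorem comulHom_ι (x : g) : comulHom p k g (ι p k x) = ι p k x ⊗ₜ 1 + 1 ⊗ₜ ι p k x := by
  simp only [comulHom, lift_ι]; rfl

instance : Bialgebra k (RestrictedEnvelopingAlgebra p k g) :=
  Bialgebra.ofAlgHom (comulHom p k g) (counitHom p k g)
    (hom_ext fun x => by
      simp [TensorProduct.add_tmul, TensorProduct.tmul_add, Algebra.TensorProduct.one_def]
      abel)
    (hom_ext fun x => by simp)
    (hom_ext fun x => by simp)

theorem comul_ι (x : g) :
    Coalgebra.comul (R := k) (ι p k x) = ι p k x ⊗ₜ[k] 1 + 1 ⊗ₜ[k] ι p k x :=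
  comulHom_ι p k x

end RestrictedEnvelopingAlgebra

end Enveloping

/-! ### The cobar construction and `H²(k, H)` -/

section Cobar

variable (k : Type*) (H : Type*) [Field k] [Ring H] [Bialgebra k H]

/-- The differential `d¹ = 1 ⊗ I - Δ + I ⊗ 1` of the cobar construction. -/
def cobarD1 : H →ₗ[k] H ⊗[k] H :=
  TensorProduct.mk k H H 1 - Coalgebra.comul + (TensorProduct.mk k H H).flip 1

/-- The differential `d² = 1 ⊗ I ⊗ I - Δ ⊗ I + I ⊗ Δ - I ⊗ I ⊗ 1` of the cobar construction. -/
def cobarD2 : H ⊗[k] H →ₗ[k] H ⊗[k] (H ⊗[k] H) :=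
  TensorProduct.mk k H (H ⊗[k] H) 1
    - (TensorProduct.assoc k H H H).toLinearMap ∘ₗ LinearMap.rTensor H Coalgebra.comul
    + LinearMap.lTensor H Coalgebra.comul
    - (TensorProduct.assoc k H H H).toLinearMap ∘ₗ (TensorProduct.mk k (H ⊗[k] H) H).flip 1

theorem cobarD2_comp_cobarD1 : cobarD2 k H ∘ₗ cobarD1 k H = 0 := by
  ext a
  simp [cobarD1, cobarD2, Algebra.TensorProduct.one_def, TensorProduct.tmul_add,
    TensorProduct.tmul_sub]
  abel

/-- The space of 2-cocycles of the cobar construction. -/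
abbrev CobarZ2 : Submodule k (H ⊗[k] H) := LinearMap.ker (cobarD2 k H)

/-- The second Hochschild cohomology `H²(k, H) = Ker d² / Im d¹` of the coalgebra `H` with
coefficients in the trivial bicomodule `k`. -/
abbrev CobarH2 : Type _ := CobarZ2 k H ⧸ (LinearMap.range (cobarD1 k H)).submoduleOf (CobarZ2 k H)

variable {k H} in
/-- The class in `H²(k, H)` of a 2-cocycle. -/
def CobarH2.mk (z : H ⊗[k] H) (hz : cobarD2 k H z = 0) : CobarH2 k H :=
  Submodule.Quotient.mk ⟨z, hz⟩

end Cobar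

/-- For an element `x` of a bialgebra, `ω(x) = ∑_{1 ≤ i ≤ p - 1} ((p-1)! / (i! (p-i)!)) x ^ i ⊗ x ^ (p - i)`. In characteristic `p`
none of the denominators vanishes. -/
def omegaElt (p : ℕ) (k : Type*) {H : Type*} [Field k] [Ring H] [Bialgebra k H] (x : H) :
    H ⊗[k] H :=
  ∑ i ∈ Finset.Icc 1 (p - 1),
    (((p - 1).factorial : k) / ((i.factorial : k) * ((p - i).factorial : k))) •
      ((x ^ i) ⊗ₜ[k] (x ^ (p - i)))

end

/-!
The coalgebra `u(g)` does not see the bracket of `g`: it has the basis of divided power monomials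
`e a = ∏ x i ^ a i / (a i)!`, with exponents `a i < p`, and `Δ (e a) = ∑ e b ⊗ e c` over all
decompositions `a = b + c`. Two things have to be shown: that these elements form a basis of `u(g)`,
and what the second cohomology of such a coalgebra is.

The basis is the Poincaré–Birkhoff–Witt theorem for `u(g)`. Linear independence uses the space `S`
of monomials `X ^ m`, on which `g` acts by operators with `x i X ^ m = X i X ^ m + (lower terms)`
(`pbwAction`, `hasSymbol_pbwAction`); the operators are found by recursion on the degree, and the
Jacobi identity gives the commutation relations (`pbwAction_lie`). In characteristic `p` the
operators `z i` given by `x i ^ p - (x i)^[p]` commute with the action, and `z i` has the leading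
term `X i ^ p`. Hence the vectors `x ^ a z ^ c · 1` with `a i < p` form a basis of `S`
(`bijective_pAdicMap`), and `∑ z i S` is spanned by those with `c ≠ 0`. By Jacobson's formula for
`(y + z) ^ p` (`add_pow_prime_eq_jacobsonPoly`) the quotient of `S` by `∑ z i S` is a
representation of `u(g)`, and there the ordered monomials `x ^ a` carry the image of `1` to linearly
independent vectors (`linearIndependent_envMonomial`). That they span `u(g)` follows by sorting
(`ι_mul_truncMonomial`, `span_truncMonomial`).

In coordinates, a 2-cocycle is a function `f (b, c)` of two truncated exponent vectors with
`f (b + c, d) = f (b, c + d)` for nonzero arguments, where `f` is zero if a sum leaves the range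
`0, …, p - 1`. So `f (b, c)` with nonzero `b`, `c` can change only with `b + c`, except that
`f (e i, e j)` and `f (e j, e i)` are unrelated; and `f (b, c)` vanishes if a carry occurs in
`b + c`, except for `b + c = p e i`. A cocycle with `f (e i, e j) = f (e j, e i)` and
`f (e i, (p - 1) e i) = 0` is therefore a coboundary (`IsTruncCocycle.exists_coboundary`). The
functionals `f (e i, (p - 1) e i)` and `f (e i, e j) - f (e j, e i)`, for `i < j`, vanish on
coboundaries and are, up to the factor `(p - 1)!`, dual to the cocycles `ω (x i)` and `x i ⊗ x j`.
-/

open scoped TensorProduct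

noncomputable section

/-! ### Monomials and the degree filtration -/

section Monomials

variable {n : ℕ}

/-- The total degree of an exponent vector. -/
def expDeg (m : Fin n → ℕ) : ℕ := ∑ i, m i

theorem expDeg_add (a b : Fin n → ℕ) : expDeg (a + b) = expDeg a + expDeg b := by
  simp [expDeg, Finset.sum_add_distrib]

@[simp]
theorem expDeg_single (i : Fin n) (r : ℕ) : expDeg (Pi.single i r) = r := by
  simp [expDeg]

@[simp]
theorem expDeg_zero : expDeg (0 : Fin n → ℕ) = 0 := by simp [expDeg]

theorem sub_single_add {m : Fin n → ℕ} {j : Fin n} (h : m j ≠ 0) :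
    m - Pi.single j 1 + Pi.single j 1 = m := by
  ext l
  by_cases hl : l = j
  · subst hl; simp; omega
  · simp [hl]

theorem expDeg_sub_single {m : Fin n → ℕ} {j : Fin n} (h : m j ≠ 0) :
    expDeg (m - Pi.single j 1) + 1 = expDeg m := by
  conv_rhs => rw [← sub_single_add h, expDeg_add, expDeg_single]

theorem exists_first {m : Fin n → ℕ} {i : Fin n} (h : m i ≠ 0) :
    ∃ j ≤ i, m j ≠ 0 ∧ ∀ l < j, m l = 0 := by
  classical
  have hne : (Finset.univ.filter fun l => m l ≠ 0).Nonempty := ⟨i, by simpa using h⟩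
  refine ⟨(Finset.univ.filter fun l => m l ≠ 0).min' hne, Finset.min'_le _ i (by simpa using h),
    ?_, ?_⟩
  · simpa using Finset.min'_mem _ hne
  · intro l hl
    by_contra hl0
    exact absurd (Finset.min'_le _ l (by simpa using hl0)) (not_le.mpr hl)

/-- The vector space with the monomials in `n` variables as basis, the underlying space of the
symmetric algebra on `n` generators. The monomial `X ^ m` is `Finsupp.single m 1`. -/
abbrev MonomialSpace (n : ℕ) (k : Type*) [Field k] : Type _ := (Fin n → ℕ) →₀ k

variable (n) (k : Type*) [Field k]

/-- The span of the monomials of degree strictly less than `d`. -/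
def degLT (d : ℕ) : Submodule k (MonomialSpace n k) :=
  Submodule.span k ((fun m => Finsupp.single m 1) '' {m | expDeg m < d})

variable {n k}

theorem degLT_mono {d e : ℕ} (h : d ≤ e) : degLT n k d ≤ degLT n k e :=
  Submodule.span_mono (Set.image_mono fun _ hm => lt_of_lt_of_le hm h)

theorem single_mem_degLT {m : Fin n → ℕ} {d : ℕ} (h : expDeg m < d) :
    (Finsupp.single m 1 : MonomialSpace n k) ∈ degLT n k d :=
  Submodule.subset_span ⟨m, h, rfl⟩

theorem degLT_zero : degLT n k 0 = ⊥ := by simp [degLT]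

theorem exists_mem_degLT (f : MonomialSpace n k) : ∃ d, f ∈ degLT n k d := by
  induction f using Finsupp.induction_linear with
  | zero => exact ⟨0, zero_mem _⟩
  | add f g hf hg =>
    obtain ⟨d, hd⟩ := hf
    obtain ⟨e, he⟩ := hg
    exact ⟨max d e, add_mem (degLT_mono (le_max_left _ _) hd) (degLT_mono (le_max_right _ _) he)⟩
  | single m c =>
    refine ⟨expDeg m + 1, ?_⟩
    rw [← mul_one c, ← smul_eq_mul, ← Finsupp.smul_single]
    exact Submodule.smul_mem _ _ (single_mem_degLT (Nat.lt_succ_self _))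

/-- To map the filtration step `degLT d` into a submodule it suffices to map its monomials. -/
theorem map_mem_of_degLT {V : Type*} [AddCommGroup V] [Module k V]
    (T : MonomialSpace n k →ₗ[k] V) (W : Submodule k V) (d : ℕ)
    (h : ∀ m, expDeg m < d → T (Finsupp.single m 1) ∈ W) {f : MonomialSpace n k}
    (hf : f ∈ degLT n k d) : T f ∈ W := by
  have : degLT n k d ≤ W.comap T := by
    refine Submodule.span_le.mpr ?_
    rintro _ ⟨m, hm, rfl⟩
    exact h m hm
  exact this hf

/-- `T` agrees with multiplication by the monomial `X ^ a` up to terms of lower degree. -/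
def HasSymbol (T : MonomialSpace n k →ₗ[k] MonomialSpace n k) (a : Fin n → ℕ) : Prop :=
  ∀ m, T (Finsupp.single m 1) - Finsupp.single (a + m) 1 ∈ degLT n k (expDeg a + expDeg m)

theorem HasSymbol.mem_degLT {T : MonomialSpace n k →ₗ[k] MonomialSpace n k} {a : Fin n → ℕ}
    (hT : HasSymbol T a) {d : ℕ} {f : MonomialSpace n k} (hf : f ∈ degLT n k d) :
    T f ∈ degLT n k (expDeg a + d) := by
  refine map_mem_of_degLT T _ d (fun m hm => ?_) hf
  rw [← sub_add_cancel (T (Finsupp.single m 1)) (Finsupp.single (a + m) 1)]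
  refine add_mem (degLT_mono (by omega) (hT m)) (single_mem_degLT ?_)
  rw [expDeg_add]; omega

theorem HasSymbol.one : HasSymbol (1 : MonomialSpace n k →ₗ[k] MonomialSpace n k) 0 := by
  intro m; simp

theorem HasSymbol.mul {T T' : MonomialSpace n k →ₗ[k] MonomialSpace n k} {a a' : Fin n → ℕ}
    (hT : HasSymbol T a) (hT' : HasSymbol T' a') : HasSymbol (T * T') (a + a') := by
  intro m
  have h1 := hT.mem_degLT (hT' m)
  have h2 := hT (a' + m)
  rw [map_sub] at h1
  have := add_mem h1 (degLT_mono (by rw [expDeg_add]) h2)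
  rw [sub_add_sub_cancel] at this
  rwa [Module.End.mul_apply, expDeg_add, add_assoc, add_assoc]

theorem HasSymbol.pow {T : MonomialSpace n k →ₗ[k] MonomialSpace n k} {a : Fin n → ℕ}
    (hT : HasSymbol T a) (r : ℕ) : HasSymbol (T ^ r) (r • a) := by
  induction r with
  | zero => simpa using HasSymbol.one
  | succ r ih => rw [pow_succ, succ_nsmul]; exact ih.mul hT

/-- A linear endomorphism that is the identity up to terms of lower degree is bijective. -/
theorem bijective_of_hasSymbol_zero {T : MonomialSpace n k →ₗ[k] MonomialSpace n k}
    (hT : HasSymbol T 0) : Function.Bijective T := by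
  have key : ∀ d, ∀ f ∈ degLT n k (d + 1), T f - f ∈ degLT n k d := by
    intro d f hf
    refine map_mem_of_degLT (T - LinearMap.id) _ (d + 1) (fun m hm => ?_) hf
    have := hT m
    rw [zero_add, expDeg_zero, zero_add] at this
    exact degLT_mono (by omega) this
  constructor
  · rw [← LinearMap.ker_eq_bot, LinearMap.ker_eq_bot']
    intro f hf
    obtain ⟨d, hd⟩ := exists_mem_degLT f
    induction d with
    | zero => simpa [degLT_zero] using hd
    | succ d ih =>
      apply ih
      have := key d f hd
      rw [hf, zero_sub] at this
      simpa using this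
  · intro f
    obtain ⟨d, hd⟩ := exists_mem_degLT f
    induction d generalizing f with
    | zero => exact ⟨0, by simpa [degLT_zero, eq_comm] using hd⟩
    | succ d ih =>
      obtain ⟨h, hh⟩ := ih _ (key d f hd)
      exact ⟨f - h, by rw [map_sub, hh]; abel⟩

end Monomials

/-! ### The action of a Lie algebra on the monomial space -/

section Action

variable {n : ℕ} {k : Type*} [Field k] {g : Type*} [LieRing g] [LieAlgebra k g]
  (x : Module.Basis (Fin n) k g)

open Classical in
/-- Approximations to the action of the basis vectors of `g` on the monomial space: the `d`-th one
is correct on monomials of degree at most `d`. If no variable of `X ^ m` precedes `i`, then `x i`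
acts by multiplication with `X i`; otherwise, `X ^ m = X j * X ^ m'` with `j < i` the first
variable of `X ^ m`, and the value is forced by
`x i (x j X ^ m') = x j (x i X ^ m') + ⁅x i, x j⁆ X ^ m'`, where the leading term
`X i * X ^ m'` of `x i X ^ m'` is treated separately, as its image under `x j` is known. -/
def pbwApprox : ℕ → Fin n → (MonomialSpace n k →ₗ[k] MonomialSpace n k)
  | 0, i => Finsupp.linearCombination k fun m => Finsupp.single (Pi.single i 1 + m) 1
  | d + 1, i => Finsupp.linearCombination k fun m =>
      if h : ∃ j < i, m j ≠ 0 ∧ ∀ l < j, m l = 0 then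
        Finsupp.single (Pi.single i 1 + m) 1 +
          pbwApprox d h.choose (pbwApprox d i (Finsupp.single (m - Pi.single h.choose 1) 1)
            - Finsupp.single (Pi.single i 1 + (m - Pi.single h.choose 1)) 1) +
          x.constr k (pbwApprox d) ⁅x i, x h.choose⁆ (Finsupp.single (m - Pi.single h.choose 1) 1)
      else Finsupp.single (Pi.single i 1 + m) 1

theorem pbwApprox_zero (i : Fin n) (m : Fin n → ℕ) :
    pbwApprox x 0 i (Finsupp.single m 1) = Finsupp.single (Pi.single i 1 + m) 1 := by
  simp [pbwApprox]

theorem pbwApprox_succ_of_le {d : ℕ} {i : Fin n} {m : Fin n → ℕ} (h : ∀ l < i, m l = 0) :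
    pbwApprox x (d + 1) i (Finsupp.single m 1) = Finsupp.single (Pi.single i 1 + m) 1 := by
  have : ¬ ∃ j < i, m j ≠ 0 ∧ ∀ l < j, m l = 0 := fun ⟨j, hj, hm, _⟩ => hm (h j hj)
  simp [pbwApprox, this]

theorem pbwApprox_succ_of_lt {d : ℕ} {i j : Fin n} {m : Fin n → ℕ} (hj : j < i) (hm : m j ≠ 0)
    (h : ∀ l < j, m l = 0) :
    pbwApprox x (d + 1) i (Finsupp.single m 1) = Finsupp.single (Pi.single i 1 + m) 1 +
      pbwApprox x d j (pbwApprox x d i (Finsupp.single (m - Pi.single j 1) 1)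
        - Finsupp.single (Pi.single i 1 + (m - Pi.single j 1)) 1) +
      x.constr k (pbwApprox x d) ⁅x i, x j⁆ (Finsupp.single (m - Pi.single j 1) 1) := by
  have hex : ∃ j < i, m j ≠ 0 ∧ ∀ l < j, m l = 0 := ⟨j, hj, hm, h⟩
  have hc : hex.choose = j := by
    obtain ⟨-, h2, h3⟩ := hex.choose_spec
    rcases lt_trichotomy hex.choose j with hlt | heq | hgt
    · exact absurd (h _ hlt) h2
    · exact heq
    · exact absurd (h3 _ hgt) hm
  rw [pbwApprox, Finsupp.linearCombination_single, one_smul, dif_pos hex, hc]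

theorem hasSymbol_pbwApprox (d : ℕ) (i : Fin n) :
    HasSymbol (pbwApprox x d i) (Pi.single i 1) := by
  induction d generalizing i with
  | zero => intro m; simp [pbwApprox_zero]
  | succ d ih =>
    intro m
    by_cases h : ∀ l < i, m l = 0
    · simp [pbwApprox_succ_of_le x h]
    · push Not at h
      obtain ⟨l, hl, hml⟩ := h
      obtain ⟨j, hjl, hmj, hj⟩ := exists_first hml
      rw [pbwApprox_succ_of_lt x (hjl.trans_lt hl) hmj hj, add_assoc, add_sub_cancel_left]
      have hd := expDeg_sub_single hmj
      refine add_mem ?_ ?_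
      · have := (ih j).mem_degLT (ih i (m - Pi.single j 1))
        rw [expDeg_single, expDeg_single] at this
        rw [expDeg_single]
        exact degLT_mono (by omega) this
      · rw [Module.Basis.constr_apply_fintype, LinearMap.sum_apply]
        refine Submodule.sum_mem _ fun l _ => ?_
        rw [LinearMap.smul_apply]
        refine Submodule.smul_mem _ _ ?_
        have := (ih l).mem_degLT
          (single_mem_degLT (k := k) (Nat.lt_succ_self (expDeg (m - Pi.single j 1))))
        rw [expDeg_single] at this ⊢
        exact degLT_mono (by omega) this

/-- The `d`-th approximation is final on monomials of degree at most `d`. -/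
theorem pbwApprox_stable (d : ℕ) (i : Fin n) {f : MonomialSpace n k} (hf : f ∈ degLT n k (d + 1)) :
    pbwApprox x (d + 1) i f = pbwApprox x d i f := by
  have hlin : ∀ (d : ℕ), (∀ i, ∀ f ∈ degLT n k (d + 1),
      pbwApprox x (d + 1) i f = pbwApprox x d i f) → ∀ y, ∀ f ∈ degLT n k (d + 1),
      x.constr k (pbwApprox x (d + 1)) y f = x.constr k (pbwApprox x d) y f := by
    intro d h y f hf
    simp only [Module.Basis.constr_apply_fintype, LinearMap.sum_apply, LinearMap.smul_apply]
    exact Finset.sum_congr rfl fun l _ => by rw [h l f hf]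
  induction d generalizing i f with
  | zero =>
    rw [← sub_eq_zero, ← LinearMap.sub_apply, ← Submodule.mem_bot k]
    refine map_mem_of_degLT _ _ 1 (fun m hm => ?_) hf
    have hm0 : ∀ l < i, m l = 0 := by
      intro l _
      have : expDeg m = 0 := by omega
      simpa using (Finset.sum_eq_zero_iff.mp this) l
    simp [pbwApprox_succ_of_le x hm0, pbwApprox_zero]
  | succ d ih =>
    rw [← sub_eq_zero, ← LinearMap.sub_apply, ← Submodule.mem_bot k]
    refine map_mem_of_degLT _ _ (d + 1 + 1) (fun m hm => ?_) hf
    rw [LinearMap.sub_apply, Submodule.mem_bot, sub_eq_zero]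
    by_cases h : ∀ l < i, m l = 0
    · rw [pbwApprox_succ_of_le x h, pbwApprox_succ_of_le x h]
    · push Not at h
      obtain ⟨l, hl, hml⟩ := h
      obtain ⟨j, hjl, hmj, hj⟩ := exists_first hml
      have hd := expDeg_sub_single hmj
      have hsm : (Finsupp.single (m - Pi.single j 1) 1 : MonomialSpace n k) ∈ degLT n k (d + 1) :=
        single_mem_degLT (by omega)
      rw [pbwApprox_succ_of_lt x (hjl.trans_lt hl) hmj hj,
        pbwApprox_succ_of_lt x (hjl.trans_lt hl) hmj hj, hlin d (fun i f hf => ih i hf) _ _ hsm,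
        ih i hsm, ih j]
      refine degLT_mono ?_ (hasSymbol_pbwApprox x d i (m - Pi.single j 1))
      rw [expDeg_single]; omega

theorem pbwApprox_eq_of_le {d e : ℕ} (h : d ≤ e) (i : Fin n) {f : MonomialSpace n k}
    (hf : f ∈ degLT n k (d + 1)) : pbwApprox x e i f = pbwApprox x d i f := by
  induction e, h using Nat.le_induction with
  | base => rfl
  | succ e he ih => rw [pbwApprox_stable x e i (degLT_mono (by omega) hf), ih]

/-- The action of the basis vector `x i` on the monomial space. -/
def pbwBasisAction (i : Fin n) : MonomialSpace n k →ₗ[k] MonomialSpace n k :=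
  Finsupp.linearCombination k fun m => pbwApprox x (expDeg m) i (Finsupp.single m 1)

theorem pbwBasisAction_eq (d : ℕ) (i : Fin n) {f : MonomialSpace n k}
    (hf : f ∈ degLT n k (d + 1)) : pbwBasisAction x i f = pbwApprox x d i f := by
  rw [← sub_eq_zero, ← LinearMap.sub_apply, ← Submodule.mem_bot k]
  refine map_mem_of_degLT _ _ (d + 1) (fun m hm => ?_) hf
  rw [LinearMap.sub_apply, Submodule.mem_bot, sub_eq_zero, pbwBasisAction,
    Finsupp.linearCombination_single, one_smul,
    pbwApprox_eq_of_le x (show expDeg m ≤ d by omega) i (single_mem_degLT (Nat.lt_succ_self _))]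

theorem hasSymbol_pbwBasisAction (i : Fin n) : HasSymbol (pbwBasisAction x i) (Pi.single i 1) := by
  intro m
  rw [pbwBasisAction_eq x (expDeg m) i (single_mem_degLT (Nat.lt_succ_self _))]
  exact hasSymbol_pbwApprox x _ i m

/-- The action of `g` on the monomial space, as a linear map. -/
def pbwAction : g →ₗ[k] (MonomialSpace n k →ₗ[k] MonomialSpace n k) :=
  x.constr k (pbwBasisAction x)

theorem pbwAction_basis (i : Fin n) : pbwAction x (x i) = pbwBasisAction x i := by
  simp [pbwAction]

theorem hasSymbol_pbwAction (i : Fin n) : HasSymbol (pbwAction x (x i)) (Pi.single i 1) := by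
  rw [pbwAction_basis]; exact hasSymbol_pbwBasisAction x i

theorem pbwAction_mem_degLT (y : g) {d : ℕ} {f : MonomialSpace n k} (hf : f ∈ degLT n k d) :
    pbwAction x y f ∈ degLT n k (d + 1) := by
  rw [pbwAction, Module.Basis.constr_apply_fintype, LinearMap.sum_apply]
  refine Submodule.sum_mem _ fun l _ => ?_
  rw [LinearMap.smul_apply]
  refine Submodule.smul_mem _ _ ?_
  have := (hasSymbol_pbwBasisAction x l).mem_degLT hf
  rwa [expDeg_single, add_comm] at this

theorem pbwAction_of_le {i : Fin n} {m : Fin n → ℕ} (h : ∀ l < i, m l = 0) :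
    pbwAction x (x i) (Finsupp.single m 1) = Finsupp.single (Pi.single i 1 + m) 1 := by
  rw [pbwAction_basis,
    pbwBasisAction_eq x (expDeg m + 1) i (single_mem_degLT (by omega)), pbwApprox_succ_of_le x h]

/-- The commutation relation of `x i` and `x j`, on a monomial none of whose variables precedes
`j < i`, is the recursion that defines the action. -/
theorem pbwAction_comm_of_le {i j : Fin n} {m : Fin n → ℕ} (hj : j < i) (h : ∀ l < j, m l = 0) :
    pbwAction x (x i) (pbwAction x (x j) (Finsupp.single m 1)) =
      pbwAction x (x j) (pbwAction x (x i) (Finsupp.single m 1)) +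
        pbwAction x ⁅x i, x j⁆ (Finsupp.single m 1) := by
  have hm : ((Pi.single j 1 + m : Fin n → ℕ)) j ≠ 0 := by simp
  have hl : ∀ l < j, (Pi.single j 1 + m : Fin n → ℕ) l = 0 := by
    intro l hl
    simp [h l hl, hl.ne]
  have hsub : (Pi.single j 1 + m : Fin n → ℕ) - Pi.single j 1 = m := by
    ext l; simp
  have hlin : x.constr k (pbwApprox x (expDeg m)) ⁅x i, x j⁆ (Finsupp.single m 1) =
      pbwAction x ⁅x i, x j⁆ (Finsupp.single m 1) := by
    simp only [pbwAction, Module.Basis.constr_apply_fintype, LinearMap.sum_apply,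
      LinearMap.smul_apply]
    exact Finset.sum_congr rfl fun l _ => by
      rw [pbwBasisAction_eq x (expDeg m) l (single_mem_degLT (Nat.lt_succ_self _))]
  have hlow := hasSymbol_pbwBasisAction x i m
  rw [expDeg_single, add_comm 1] at hlow
  have hlead : pbwAction x (x j) (Finsupp.single (Pi.single i 1 + m) 1) =
      Finsupp.single (Pi.single i 1 + (Pi.single j 1 + m)) 1 := by
    rw [pbwAction_of_le x, add_left_comm]
    intro l hl
    simp [h l hl, (hl.trans hj).ne]
  rw [pbwAction_of_le x h, pbwAction_basis x i,
    pbwBasisAction_eq x (expDeg m + 1) i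
      (single_mem_degLT (by rw [expDeg_add, expDeg_single]; omega)),
    pbwApprox_succ_of_lt x hj hm hl, hsub, hlin, ← hlead,
    ← pbwBasisAction_eq x (expDeg m) i (single_mem_degLT (Nat.lt_succ_self _)),
    ← pbwBasisAction_eq x (expDeg m) j hlow, ← pbwAction_basis x j, ← map_add, add_sub_cancel]

/-- The commutation relations on polynomials of degree less than `d`, by induction on `d`. -/
theorem pbwAction_lie_of_mem (d : ℕ) : ∀ y z : g, ∀ f ∈ degLT n k d,
    pbwAction x y (pbwAction x z f) =
      pbwAction x z (pbwAction x y f) + pbwAction x ⁅y, z⁆ f := by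
  induction d with
  | zero =>
    intro y z f hf
    rw [degLT_zero, Submodule.mem_bot] at hf
    simp [hf]
  | succ d ih =>
    have hlt : ∀ i j : Fin n, j < i → ∀ f ∈ degLT n k (d + 1),
        pbwAction x (x i) (pbwAction x (x j) f) =
          pbwAction x (x j) (pbwAction x (x i) f) + pbwAction x ⁅x i, x j⁆ f := by
      intro i j hji f hf
      have hgoal : ∀ f, pbwAction x (x i) (pbwAction x (x j) f) =
          pbwAction x (x j) (pbwAction x (x i) f) + pbwAction x ⁅x i, x j⁆ f ↔
          (pbwAction x (x i) * pbwAction x (x j) - (pbwAction x (x j) * pbwAction x (x i) +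
            pbwAction x ⁅x i, x j⁆)) f ∈ (⊥ : Submodule k (MonomialSpace n k)) := by
        intro f
        simp [sub_eq_zero]
      rw [hgoal]
      refine map_mem_of_degLT _ _ (d + 1) (fun m hm => ?_) hf
      rw [← hgoal]
      by_cases hmj : ∀ l < j, m l = 0
      · exact pbwAction_comm_of_le x hji hmj
      push Not at hmj
      obtain ⟨l, hl, hml⟩ := hmj
      obtain ⟨h, hhl, hmh, hh⟩ := exists_first hml
      have hhj : h < j := hhl.trans_lt hl
      have hd := expDeg_sub_single hmh
      set m' := m - Pi.single h 1 with hm'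
      have hm'h : ∀ l < h, m' l = 0 := fun l hl => by simp [hm', hh l hl]
      have hF : (Finsupp.single m' 1 : MonomialSpace n k) ∈ degLT n k d :=
        single_mem_degLT (by omega)
      have hmF : Finsupp.single m 1 = pbwAction x (x h) (Finsupp.single m' (1 : k)) := by
        rw [pbwAction_of_le x hm'h, add_comm, hm', sub_single_add hmh]
      -- Both `x i x j` and `x j x i` are moved past `x h`; the Jacobi identity compares the
      -- results. The leading term of `x b X ^ m'` has the same degree as `X ^ m`, so that the
      -- induction hypothesis does not apply to it, but its variables do not precede `h`.
      have move : ∀ a b : Fin n, h < a → h < b →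
          pbwAction x (x a) (pbwAction x (x b) (Finsupp.single m 1)) =
            pbwAction x (x h) (pbwAction x (x a) (pbwAction x (x b) (Finsupp.single m' 1))) +
            pbwAction x ⁅x a, x h⁆ (pbwAction x (x b) (Finsupp.single m' 1)) +
            pbwAction x (x a) (pbwAction x ⁅x b, x h⁆ (Finsupp.single m' 1)) := by
        intro a b ha hb
        rw [hmF, ih (x b) (x h) _ hF, map_add]
        congr 1
        have hlow := hasSymbol_pbwAction x b m'
        rw [expDeg_single] at hlow
        have hc : ∀ l < h, (Pi.single b 1 + m' : Fin n → ℕ) l = 0 := fun l hl => by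
          simp [hm'h l hl, (hl.trans hb).ne]
        have h1 := ih (x a) (x h) _ (degLT_mono (by omega) hlow)
        have h2 := pbwAction_comm_of_le x ha hc
        have h3 := congrArg₂ (· + ·) h1 h2
        simp only [map_sub] at h3
        rw [← sub_eq_zero] at h3 ⊢
        rw [← h3]
        abel
      rw [move i j (hhj.trans hji) hhj, move j i hhj (hhj.trans hji), ih (x i) (x j) _ hF, map_add,
        hmF, ih (x i) ⁅x j, x h⁆ _ hF, ih ⁅x i, x h⁆ (x j) _ hF,
        ih ⁅x i, x j⁆ (x h) _ hF]
      have jac : pbwAction x ⁅⁅x i, x j⁆, x h⁆ (Finsupp.single m' 1) =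
          pbwAction x ⁅⁅x i, x h⁆, x j⁆ (Finsupp.single m' 1) +
          pbwAction x ⁅x i, ⁅x j, x h⁆⁆ (Finsupp.single m' 1) := by
        rw [← LinearMap.add_apply, ← map_add, lie_lie (x i) (x j), ← lie_skew ⁅x i, x h⁆]
        congr 2
        abel
      rw [jac]
      abel
    have hall : ∀ i j : Fin n, ∀ f ∈ degLT n k (d + 1),
        pbwAction x (x i) (pbwAction x (x j) f) =
          pbwAction x (x j) (pbwAction x (x i) f) + pbwAction x ⁅x i, x j⁆ f := by
      intro i j f hf
      rcases lt_trichotomy j i with hji | rfl | hij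
      · exact hlt i j hji f hf
      · simp
      · rw [hlt j i hij f hf, add_assoc, ← lie_skew (x i), map_neg, LinearMap.neg_apply]
        simp
    intro y z f hf
    induction x.mem_span y using Submodule.span_induction with
    | zero => simp
    | mem y hy =>
      obtain ⟨i, rfl⟩ := hy
      induction x.mem_span z using Submodule.span_induction with
      | zero => simp
      | mem z hz =>
        obtain ⟨j, rfl⟩ := hz
        exact hall i j f hf
      | add z z' _ _ hz hz' =>
        simp only [map_add, LinearMap.add_apply, lie_add, hz, hz']
        abel
      | smul c z _ hz => simp only [map_smul, LinearMap.smul_apply, lie_smul, hz, smul_add]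
    | add y y' _ _ hy hy' =>
      simp only [map_add, LinearMap.add_apply, add_lie, hy, hy']
      abel
    | smul c y _ hy => simp only [map_smul, LinearMap.smul_apply, smul_lie, hy, smul_add]

/-- The operators of `pbwAction` form a representation of `g`. -/
theorem pbwAction_lie (y z : g) :
    pbwAction x ⁅y, z⁆ =
      pbwAction x y * pbwAction x z - pbwAction x z * pbwAction x y := by
  refine Finsupp.lhom_ext' fun m => LinearMap.ext_ring ?_
  have := pbwAction_lie_of_mem x (expDeg m + 1) y z _ (single_mem_degLT (Nat.lt_succ_self _))
  simp only [LinearMap.comp_apply, Finsupp.lsingle_apply, LinearMap.sub_apply,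
    Module.End.mul_apply, this, add_sub_cancel_left]

end Action

/-! ### Jacobson's formula in an associative algebra -/

section Jacobson

open Polynomial

theorem cast_choose_pred_prime {R : Type*} [Ring R] {p : ℕ} (hp : p.Prime) (h0 : (p : R) = 0)
    {m : ℕ} (hm : m < p) : ((p - 1).choose m : R) = (-1) ^ m := by
  induction m with
  | zero => simp
  | succ m ih =>
    have h1 : p.choose (m + 1) = (p - 1).choose m + (p - 1).choose (m + 1) := by
      conv_lhs => rw [← Nat.succ_pred_eq_of_pos hp.pos, Nat.choose_succ_succ]
      rfl
    obtain ⟨c, hc⟩ := hp.dvd_choose_self (Nat.succ_ne_zero m) hm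
    have h2 : ((p - 1).choose m : R) + ((p - 1).choose (m + 1) : R) = 0 := by
      rw [← Nat.cast_add, ← h1, hc, Nat.cast_mul, h0, zero_mul]
    rw [ih (by omega)] at h2
    rw [pow_succ, mul_neg_one]
    exact eq_neg_of_add_eq_zero_right h2

/-- In characteristic `p` all signed binomial coefficients of `(a - b) ^ (p - 1)` are `1`. -/
theorem Commute.sub_pow_pred_prime {R : Type*} [Ring R] {p : ℕ} (hp : p.Prime)
    (h0 : (p : R) = 0) {a b : R} (h : Commute a b) :
    (a - b) ^ (p - 1) = ∑ j ∈ Finset.range p, a ^ j * b ^ (p - 1 - j) := by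
  have hneg : (-1 : R) ^ (p - 1) = 1 := by
    rw [← cast_choose_pred_prime hp h0 (Nat.sub_lt hp.pos one_pos), Nat.choose_self, Nat.cast_one]
  rw [sub_eq_add_neg, h.neg_right.add_pow, Nat.sub_add_cancel hp.one_le]
  refine Finset.sum_congr rfl fun j hj => ?_
  have hj := Finset.mem_range.mp hj
  rw [cast_choose_pred_prime hp h0 hj, neg_pow b, mul_assoc, mul_assoc]
  congr 1
  rw [((Commute.neg_one_left (b ^ (p - 1 - j))).pow_left j).symm.eq, ← mul_assoc, ← pow_add,
    Nat.sub_add_cancel (by omega), hneg, one_mul]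

theorem Commute.sub_pow_prime {R : Type*} [Ring R] {p : ℕ} (hp : p.Prime)
    (h0 : (p : R) = 0) {a b : R} (h : Commute a b) : (a - b) ^ p = a ^ p - b ^ p := by
  rw [← h.mul_geom_sum₂, ← h.sub_pow_pred_prime hp h0, ← pow_succ',
    Nat.sub_add_cancel hp.one_le]

variable {p : ℕ} [hp : Fact p.Prime] {k : Type*} [Field k] [CharP k p]
  {A : Type*} [Ring A] [Algebra k A]

omit hp in
variable (p k) in
theorem natCast_char_eq_zero (R : Type*) [Ring R] [Algebra k R] : (p : R) = 0 := by
  rw [← map_natCast (algebraMap k R), CharP.cast_eq_zero, map_zero]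

theorem iterate_commutator (a : A) (m : ℕ) (u : A) :
    (fun u => u * a - a * u)^[m] u =
      ((LinearMap.mulRight ℤ a - LinearMap.mulLeft ℤ a) ^ m) u := by
  rw [Module.End.pow_apply]
  congr 1

omit hp in
theorem natCast_end_eq_zero (h0 : (p : A) = 0) : (p : Module.End ℤ A) = 0 := by
  ext u
  rw [Module.End.natCast_apply, nsmul_eq_mul, h0, zero_mul, LinearMap.zero_apply]

/-- In characteristic `p`, the `p`-th power of `ad a` is `ad (a ^ p)`. -/
theorem iterate_commutator_prime (h0 : (p : A) = 0) (a u : A) :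
    (fun u => u * a - a * u)^[p] u = u * a ^ p - a ^ p * u := by
  rw [iterate_commutator, Commute.sub_pow_prime hp.out (natCast_end_eq_zero h0)
    (LinearMap.commute_mulLeft_right (R := ℤ) a a).symm]
  simp [LinearMap.pow_mulLeft, LinearMap.pow_mulRight]

theorem iterate_commutator_pred_prime (h0 : (p : A) = 0) (a u : A) :
    (fun u => u * a - a * u)^[p - 1] u =
      ∑ j ∈ Finset.range p, a ^ (p - 1 - j) * u * a ^ j := by
  rw [iterate_commutator, Commute.sub_pow_pred_prime hp.out (natCast_end_eq_zero h0)
    (LinearMap.commute_mulLeft_right (R := ℤ) a a).symm]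
  simp [LinearMap.pow_mulLeft, LinearMap.pow_mulRight, mul_assoc]

theorem derivative_pow_noncomm (f : A[X]) (m : ℕ) :
    derivative (f ^ m) = ∑ j ∈ Finset.range m, f ^ (m - 1 - j) * derivative f * f ^ j := by
  induction m with
  | zero => simp
  | succ m ih =>
    rw [pow_succ', derivative_mul, ih, Finset.sum_range_succ, Finset.mul_sum, add_comm]
    congr 1
    · refine Finset.sum_congr rfl fun j hj => ?_
      have hj := Finset.mem_range.mp hj
      rw [← mul_assoc, ← mul_assoc, ← pow_succ']
      congr 3
      omega
    · simp

variable {g : Type*} [LieRing g] [LieAlgebra k g] (ρ : g →ₗ[k] A)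
  (hρ : ∀ y z, ρ ⁅y, z⁆ = ρ y * ρ z - ρ z * ρ y)

include hρ

/-- `adPowCoeff y z m` lists the coefficients of the polynomial `y (ad (λ y + z)) ^ m` in the formal
variable `λ`. -/
theorem coeff_iterate_commutator (y z : g) (m i : ℕ) :
    ((fun u => u * (C (ρ y) * X + C (ρ z)) - (C (ρ y) * X + C (ρ z)) * u)^[m] (C (ρ y))).coeff i =
      ρ (adPowCoeff y z m i) := by
  induction m generalizing i with
  | zero =>
    cases i with
    | zero => simp [adPowCoeff]
    | succ i => simp [adPowCoeff]
  | succ m ih =>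
    rw [Function.iterate_succ_apply']
    set u := (fun u => u * (C (ρ y) * X + C (ρ z)) - (C (ρ y) * X + C (ρ z)) * u)^[m] (C (ρ y))
    have hu : u * (C (ρ y) * X + C (ρ z)) - (C (ρ y) * X + C (ρ z)) * u =
        (u * C (ρ y) - C (ρ y) * u) * X + (u * C (ρ z) - C (ρ z) * u) := by
      rw [mul_add, add_mul, sub_mul, mul_assoc (C (ρ y)) X u, X_mul, mul_assoc, mul_assoc]
      abel
    rw [hu]
    cases i with
    | zero => simp [adPowCoeff, hρ, ih]
    | succ i => simp [adPowCoeff, hρ, ih]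

/-- Jacobson's formula: the coefficient of `λ ^ i` in `(λ y + z) ^ p` is found from the derivative
of this polynomial, which is `y (ad (λ y + z)) ^ (p - 1)`. -/
theorem add_pow_prime_eq_jacobsonPoly (y z : g) :
    (ρ y + ρ z) ^ p =
      ρ y ^ p + ρ z ^ p + ρ (∑ i ∈ Finset.Icc 1 (p - 1), jacobsonPoly p k i y z) := by
  have hpp := hp.out
  set f : A[X] := C (ρ y) * X + C (ρ z) with hf
  have hdf : derivative f = C (ρ y) := by simp [hf]
  have hcoeff : ∀ i ∈ Finset.Icc 1 (p - 1), (f ^ p).coeff i = ρ (jacobsonPoly p k i y z) := by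
    intro i hi
    obtain ⟨hi1, hi2⟩ := Finset.mem_Icc.mp hi
    have hik : (i : k) ≠ 0 := by
      rw [Ne, CharP.cast_eq_zero_iff k p]
      exact fun h => absurd (Nat.le_of_dvd hi1 h) (by have := hpp.pos; omega)
    have h1 := congrArg (fun q => q.coeff (i - 1)) (derivative_pow_noncomm f p).symm
    simp only [hdf] at h1
    rw [← iterate_commutator_pred_prime (natCast_char_eq_zero p k _),
      coeff_iterate_commutator ρ hρ, coeff_derivative,
      Nat.sub_add_cancel hi1] at h1
    rw [jacobsonPoly, map_smul, h1, ← Nat.cast_add_one, Nat.sub_add_cancel hi1,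
      ← map_natCast (algebraMap k A), ← Algebra.commutes, ← Algebra.smul_def, smul_smul,
      inv_mul_cancel₀ hik, one_smul]
  have hdeg : f.natDegree ≤ 1 := natDegree_linear_le
  have hdegp : (f ^ p).natDegree < p + 1 := by
    have := natDegree_pow_le_of_le p hdeg
    omega
  have h0 : (f ^ p).coeff 0 = ρ z ^ p := by
    have : ∀ m : ℕ, (f ^ m).coeff 0 = ρ z ^ m := by
      intro m
      induction m with
      | zero => simp
      | succ m ih => rw [pow_succ, mul_coeff_zero, ih, pow_succ]; simp [hf]
    exact this p
  have hlead : (f ^ p).coeff p = ρ y ^ p := by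
    have := coeff_pow_of_natDegree_le (m := p) hdeg
    rw [mul_one] at this
    rw [this]
    simp [hf, coeff_C]
  have heval : (ρ y + ρ z) ^ p = ∑ i ∈ Finset.range (p + 1), (f ^ p).coeff i := by
    have h1 : eval₂RingHom' (RingHom.id A) 1 (fun a => Commute.one_right _) (f ^ p) =
        (ρ y + ρ z) ^ p := by
      rw [map_pow]
      congr 1
      rw [hf, map_add, map_mul]
      simp [eval₂RingHom']
    rw [← h1]
    change eval₂ _ _ _ = _
    rw [eval₂_eq_sum_range' _ hdegp]
    simp
  rw [heval, Finset.sum_range_succ, hlead, Finset.range_eq_Ico, Finset.sum_eq_sum_Ico_succ_bot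
    hpp.pos, h0, map_sum, ← Finset.sum_congr rfl hcoeff]
  have : Finset.Ico (0 + 1) p = Finset.Icc 1 (p - 1) := by
    ext i; simp only [Finset.mem_Ico, Finset.mem_Icc]; omega
  rw [this]
  abel

variable [RestrictedLieAlgebra p k g]

/-- The element `ρ(z) ^ p - ρ(z^[p])` is central in the algebra generated by `ρ(g)`. -/
theorem commute_pow_sub_pMap (y z : g) :
    Commute (ρ y) (ρ z ^ p - ρ (RestrictedLieAlgebra.pMap p k z)) := by
  have h1 : ∀ m, ρ ((fun u => ⁅u, z⁆)^[m] y) = (fun u => u * ρ z - ρ z * u)^[m] (ρ y) := by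
    intro m
    induction m with
    | zero => rfl
    | succ m ih => rw [Function.iterate_succ_apply', Function.iterate_succ_apply', hρ, ih]
  have h2 := h1 p
  rw [iterate_commutator_prime (natCast_char_eq_zero p k _),
    ← RestrictedLieAlgebra.lie_pMap (p := p) (k := k), hρ] at h2
  rw [commute_iff_eq, mul_sub, sub_mul, sub_eq_sub_iff_sub_eq_sub, h2]

/-- If `x ^ p = x^[p]` holds for the elements of a spanning set, it holds everywhere. -/
theorem pow_eq_pMap_of_span {s : Set g} (hs : Submodule.span k s = ⊤)
    (h : ∀ y ∈ s, ρ y ^ p = ρ (RestrictedLieAlgebra.pMap p k y)) (y : g) :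
    ρ y ^ p = ρ (RestrictedLieAlgebra.pMap p k y) := by
  have hy : y ∈ Submodule.span k s := hs ▸ Submodule.mem_top
  induction hy using Submodule.span_induction with
  | zero =>
    have h0 : RestrictedLieAlgebra.pMap p k (0 : g) = 0 := by
      have := RestrictedLieAlgebra.pMap_smul (p := p) (0 : k) (0 : g)
      rwa [zero_smul, zero_pow hp.out.ne_zero, zero_smul] at this
    rw [h0, map_zero, zero_pow hp.out.ne_zero]
  | mem y hy => exact h y hy
  | add y z _ _ hy hz =>
    rw [map_add, add_pow_prime_eq_jacobsonPoly ρ hρ, hy, hz, RestrictedLieAlgebra.pMap_add, map_add,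
      map_add]
  | smul a y _ hy => rw [RestrictedLieAlgebra.pMap_smul, map_smul, map_smul, _root_.smul_pow, hy]

end Jacobson

/-! ### Ordered monomials -/

section OrderedMonomials

/-- The ordered monomial `y 0 ^ a 0 * y 1 ^ a 1 * ⋯` in a ring. -/
def ordMonomial {A : Type*} [Monoid A] {n : ℕ} (y : Fin n → A) (a : Fin n → ℕ) : A :=
  (List.ofFn fun i => y i ^ a i).prod

section
variable {A : Type*} [Monoid A] {n : ℕ}

@[simp]
theorem ordMonomial_zero (y : Fin n → A) : ordMonomial y 0 = 1 := by
  simp [ordMonomial]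

theorem ordMonomial_succ (y : Fin (n + 1) → A) (a : Fin (n + 1) → ℕ) :
    ordMonomial y a = y 0 ^ a 0 * ordMonomial (fun i => y i.succ) (fun i => a i.succ) := by
  simp [ordMonomial, List.ofFn_succ]

theorem mul_ordMonomial (y : Fin n → A) (a : Fin n → ℕ) (j : Fin n)
    (h : ∀ l < j, Commute (y j) (y l ^ a l)) :
    y j * ordMonomial y a = ordMonomial y (Pi.single j 1 + a) := by
  induction n with
  | zero => exact j.elim0
  | succ n ih =>
    rw [ordMonomial_succ, ordMonomial_succ]
    induction j using Fin.cases with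
    | zero =>
      have : (fun i : Fin n => (Pi.single 0 1 + a : Fin (n + 1) → ℕ) i.succ) =
          fun i => a i.succ := by
        ext i; simp
      rw [this, ← mul_assoc, ← pow_succ']
      simp [add_comm]
    | succ j =>
      have : (fun i : Fin n => (Pi.single j.succ 1 + a : Fin (n + 1) → ℕ) i.succ) =
          Pi.single j 1 + fun i => a i.succ := by
        ext i; by_cases hi : i = j <;> simp [hi]
      rw [this, ← ih (fun i => y i.succ) (fun i => a i.succ) j
        fun l hl => h l.succ (Fin.succ_lt_succ_iff.mpr hl), ← mul_assoc,
        (h 0 (Fin.succ_pos j)).eq, mul_assoc]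
      simp

theorem mul_ordMonomial_of_le (y : Fin n → A) {a : Fin n → ℕ} {j : Fin n}
    (h : ∀ l < j, a l = 0) : y j * ordMonomial y a = ordMonomial y (Pi.single j 1 + a) :=
  mul_ordMonomial y a j fun l hl => by rw [h l hl, pow_zero]; exact Commute.one_right _

theorem pow_mul_ordMonomial_of_le (y : Fin n → A) {a : Fin n → ℕ} {j : Fin n}
    (h : ∀ l < j, a l = 0) (r : ℕ) :
    y j ^ r * ordMonomial y a = ordMonomial y (Pi.single j r + a) := by
  induction r with
  | zero => simp
  | succ r ih =>
    rw [pow_succ', mul_assoc, ih, mul_ordMonomial_of_le, ← add_assoc, ← Pi.single_add,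
      add_comm 1 r]
    intro l hl
    simp [h l hl, hl.ne]

theorem ordMonomial_single (y : Fin n → A) (j : Fin n) (r : ℕ) :
    ordMonomial y (Pi.single j r) = y j ^ r := by
  have := pow_mul_ordMonomial_of_le y (a := 0) (j := j) (fun _ _ => rfl) r
  rw [ordMonomial_zero, mul_one, add_zero] at this
  exact this.symm

theorem Commute.ordMonomial_right {t : A} {y : Fin n → A} (h : ∀ i, Commute t (y i))
    (a : Fin n → ℕ) : Commute t (ordMonomial y a) := by
  refine Commute.list_prod_right _ _ fun u hu => ?_
  obtain ⟨i, rfl⟩ := (List.mem_ofFn' _ _).mp hu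
  exact (h i).pow_right _

end

theorem HasSymbol.ordMonomial {k : Type*} [Field k] {n r : ℕ}
    {T : Fin r → (MonomialSpace n k →ₗ[k] MonomialSpace n k)} {s : Fin r → Fin n → ℕ}
    (hT : ∀ i, HasSymbol (T i) (s i)) (a : Fin r → ℕ) :
    HasSymbol (ordMonomial T a) (∑ i, a i • s i) := by
  induction r with
  | zero => simpa [_root_.ordMonomial] using HasSymbol.one
  | succ r ih =>
    rw [ordMonomial_succ, Fin.sum_univ_succ]
    exact ((hT 0).pow _).mul (ih (fun i => hT i.succ) _)

end OrderedMonomials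

/-! ### Linear independence of the ordered monomials of `u(g)` -/

section RestrictedPBW

attribute [local instance 100] LieRing.ofAssociativeRing

open RestrictedLieAlgebra

variable {p : ℕ} [hp : Fact p.Prime] {k : Type*} [Field k] [CharP k p]
  {g : Type*} [LieRing g] [LieAlgebra k g] [RestrictedLieAlgebra p k g]
  {n : ℕ} (x : Module.Basis (Fin n) k g)

/-- A representation of `g` by operators `ρ y` extends to `u(g)` as soon as the relation
`x ^ p = x^[p]` holds for the basis vectors. -/
theorem exists_restricted_lift {A : Type*} [Ring A] [Algebra k A] (ρ : g →ₗ[k] A)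
    (hρ : ∀ y z, ρ ⁅y, z⁆ = ρ y * ρ z - ρ z * ρ y)
    (hpow : ∀ i, ρ (x i) ^ p = ρ (pMap p k (x i))) :
    ∃ φ : RestrictedEnvelopingAlgebra p k g →ₐ[k] A,
      ∀ y, φ (RestrictedEnvelopingAlgebra.ι p k y) = ρ y := by
  refine ⟨RestrictedEnvelopingAlgebra.lift p k
    { ρ with map_lie' := fun {y z} => hρ y z } ?_, fun y => ?_⟩
  · exact pow_eq_pMap_of_span ρ hρ x.span_eq (by rintro _ ⟨i, rfl⟩; exact hpow i)
  · rw [RestrictedEnvelopingAlgebra.lift_ι]; rfl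

variable (p) in
/-- The action of the central element `x i ^ p - (x i)^[p]` of the enveloping algebra on the
monomial space. -/
def pCenterAction (i : Fin n) : MonomialSpace n k →ₗ[k] MonomialSpace n k :=
  pbwAction x (x i) ^ p - pbwAction x (pMap p k (x i))

omit [CharP k p] in
theorem hasSymbol_pCenterAction (i : Fin n) : HasSymbol (pCenterAction p x i) (Pi.single i p) := by
  intro m
  have h1 := (hasSymbol_pbwAction x i).pow p m
  have h2 := pbwAction_mem_degLT x (pMap p k (x i))
    (single_mem_degLT (k := k) (Nat.lt_succ_self (expDeg m)))
  have h3 : p • (Pi.single i 1 : Fin n → ℕ) = Pi.single i p := by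
    rw [← Pi.single_smul, smul_eq_mul, mul_one]
  rw [h3] at h1
  -- As `2 ≤ p`, the action of `(x i)^[p]` only contributes terms of degree less than `p + deg m`.
  have := sub_mem h1 (degLT_mono (by have := hp.out.two_le; simp only [expDeg_single]; omega) h2)
  rwa [sub_right_comm, ← LinearMap.sub_apply] at this

theorem commute_pCenterAction_pbwAction (i : Fin n) (y : g) :
    Commute (pCenterAction p x i) (pbwAction x y) := by
  have h : Commute (pbwAction x y) (pCenterAction p x i) :=
    commute_pow_sub_pMap (p := p) (k := k) (A := Module.End k (MonomialSpace n k)) (pbwAction x)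
      (pbwAction_lie x) y (x i)
  exact h.symm

theorem commute_pCenterAction (i j : Fin n) :
    Commute (pCenterAction p x i) (pCenterAction p x j) := by
  have h1 := (commute_pCenterAction_pbwAction (p := p) x i (x j)).pow_right p
  have h2 := commute_pCenterAction_pbwAction (p := p) x i (pMap p k (x j))
  exact Commute.sub_right (R := Module.End k (MonomialSpace n k)) h1 h2

variable (p) in
/-- The operators `x ^ a * z ^ c` with `a i < p`, where `z i` is the central element
`x i ^ p - (x i)^[p]`, indexed by the exponent `m = a + p c` of their symbol. -/
def pAdicMonomial (m : Fin n → ℕ) : MonomialSpace n k →ₗ[k] MonomialSpace n k :=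
  ordMonomial (fun i => pbwAction x (x i)) (fun i => m i % p) *
    ordMonomial (pCenterAction p x) (fun i => m i / p)

omit [CharP k p] in
theorem hasSymbol_pAdicMonomial (m : Fin n → ℕ) : HasSymbol (pAdicMonomial p x m) m := by
  have h := (HasSymbol.ordMonomial (fun i => hasSymbol_pbwAction x i) (fun i => m i % p)).mul
    (HasSymbol.ordMonomial (fun i => hasSymbol_pCenterAction (p := p) x i) (fun i => m i / p))
  have hm : ∑ i, (m i % p) • (Pi.single i 1 : Fin n → ℕ) +
      ∑ i, (m i / p) • (Pi.single i p : Fin n → ℕ) = m := by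
    ext j
    simp only [Pi.add_apply, Finset.sum_apply, Pi.smul_apply, Pi.single_apply, smul_eq_mul,
      mul_ite, mul_zero, Finset.sum_ite_eq, Finset.mem_univ, if_true, mul_one]
    exact Nat.mod_add_div' (m j) p
  rwa [hm] at h

theorem pCenterAction_mul_pAdicMonomial (i : Fin n) (m : Fin n → ℕ) :
    pCenterAction p x i * pAdicMonomial p x m = pAdicMonomial p x (Pi.single i p + m) := by
  have h1 : (fun l => (Pi.single i p + m : Fin n → ℕ) l % p) = fun l => m l % p := by
    ext l
    by_cases h : l = i <;> simp [h]
  have h2 : (fun l => (Pi.single i p + m : Fin n → ℕ) l / p) =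
      Pi.single i 1 + fun l => m l / p := by
    ext l
    by_cases h : l = i
    · subst h; simp [Nat.add_div_left _ hp.out.pos, add_comm]
    · simp [h]
  rw [pAdicMonomial, pAdicMonomial, h1, h2, ← mul_assoc,
    (Commute.ordMonomial_right (fun j => commute_pCenterAction_pbwAction x i (x j)) _).eq,
    mul_assoc, mul_ordMonomial]
  exact fun l _ => (commute_pCenterAction x i l).pow_right _

variable (p) in
/-- The linear map `X ^ m ↦ (x ^ a * z ^ c) · 1` with `m = a + p c`. -/
def pAdicMap : MonomialSpace n k →ₗ[k] MonomialSpace n k :=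
  Finsupp.linearCombination k fun m => pAdicMonomial p x m (Finsupp.single 0 1)

omit hp [CharP k p] in
theorem pAdicMap_single (m : Fin n → ℕ) :
    pAdicMap p x (Finsupp.single m 1) = pAdicMonomial p x m (Finsupp.single 0 1) := by
  simp [pAdicMap]

omit [CharP k p] in
theorem bijective_pAdicMap : Function.Bijective (pAdicMap p x) := by
  refine bijective_of_hasSymbol_zero fun m => ?_
  have := hasSymbol_pAdicMonomial (p := p) x m 0
  rw [pAdicMap_single]
  simpa using this

variable (p) in
/-- The submodule `∑ z i · S` of the monomial space `S`. -/
def pCenterSubmodule : Submodule k (MonomialSpace n k) :=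
  ⨆ i, LinearMap.range (pCenterAction p x i)

/-- `∑ z i · S` lies in the span of the vectors `(x ^ a * z ^ c) · 1` with `c ≠ 0`. -/
theorem pCenterSubmodule_le :
    pCenterSubmodule p x ≤ (Finsupp.supported k k {m : Fin n → ℕ | ∃ i, p ≤ m i}).map
      (pAdicMap p x) := by
  refine iSup_le fun i => ?_
  rintro _ ⟨f, rfl⟩
  obtain ⟨f, rfl⟩ := (bijective_pAdicMap (p := p) x).2 f
  induction f using Finsupp.induction_linear with
  | zero => simp
  | add f f' hf hf' => rw [map_add, map_add]; exact add_mem hf hf'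
  | single m c =>
    rw [← mul_one c, ← smul_eq_mul, ← Finsupp.smul_single, map_smul, map_smul, pAdicMap_single,
      ← Module.End.mul_apply, pCenterAction_mul_pAdicMonomial, ← pAdicMap_single]
    refine Submodule.smul_mem _ _ (Submodule.mem_map_of_mem ?_)
    exact Finsupp.single_mem_supported k 1 ⟨i, by simp⟩

theorem pbwAction_mem_pCenterSubmodule (y : g) :
    pCenterSubmodule p x ≤ (pCenterSubmodule p x).comap (pbwAction x y) := by
  refine iSup_le fun i => ?_
  rintro _ ⟨f, rfl⟩
  rw [Submodule.mem_comap, ← Module.End.mul_apply,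
    ← (commute_pCenterAction_pbwAction x i y).eq, Module.End.mul_apply]
  exact Submodule.mem_iSup_of_mem i ⟨_, rfl⟩

/-- The quotient of the monomial space by `∑ z i · S` is a representation of `u(g)`. -/
theorem exists_action_quotient :
    ∃ φ : RestrictedEnvelopingAlgebra p k g →ₐ[k]
        Module.End k (MonomialSpace n k ⧸ pCenterSubmodule p x),
      ∀ y f, φ (RestrictedEnvelopingAlgebra.ι p k y) (Submodule.Quotient.mk f) =
        Submodule.Quotient.mk (pbwAction x y f) := by
  let ρ : g →ₗ[k] Module.End k (MonomialSpace n k ⧸ pCenterSubmodule p x) :=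
    { toFun := fun y => (pCenterSubmodule p x).mapQ _ (pbwAction x y)
        (pbwAction_mem_pCenterSubmodule x y)
      map_add' := fun y z => by
        refine LinearMap.ext fun f => ?_
        obtain ⟨f, rfl⟩ := Submodule.Quotient.mk_surjective _ f
        simp
      map_smul' := fun c y => by
        refine LinearMap.ext fun f => ?_
        obtain ⟨f, rfl⟩ := Submodule.Quotient.mk_surjective _ f
        simp }
  have hρ : ∀ y f, ρ y (Submodule.Quotient.mk f) = Submodule.Quotient.mk (pbwAction x y f) :=
    fun y f => rfl
  obtain ⟨φ, hφ⟩ := exists_restricted_lift x ρ (fun y z => by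
      refine LinearMap.ext fun f => ?_
      obtain ⟨f, rfl⟩ := Submodule.Quotient.mk_surjective _ f
      simp only [LinearMap.sub_apply, Module.End.mul_apply, hρ, pbwAction_lie,
        Submodule.Quotient.mk_sub]) (fun i => by
      refine LinearMap.ext fun f => ?_
      obtain ⟨f, rfl⟩ := Submodule.Quotient.mk_surjective _ f
      have hpow : ∀ r : ℕ, (ρ (x i) ^ r) (Submodule.Quotient.mk f) =
          Submodule.Quotient.mk ((pbwAction x (x i) ^ r) f) := by
        intro r
        induction r with
        | zero => rfl
        | succ r ih => rw [pow_succ', Module.End.mul_apply, ih, hρ, pow_succ', Module.End.mul_apply]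
      rw [hpow, hρ, Submodule.Quotient.eq]
      exact Submodule.mem_iSup_of_mem i ⟨f, rfl⟩)
  exact ⟨φ, fun y f => by rw [hφ, hρ]⟩

variable (p) in
/-- The ordered monomials in the basis vectors of `g`, as elements of `u(g)`. -/
abbrev envMonomial (a : Fin n → ℕ) : RestrictedEnvelopingAlgebra p k g :=
  ordMonomial (fun i => RestrictedEnvelopingAlgebra.ι p k (x i)) a

/-- The linear independence part of the Poincaré–Birkhoff–Witt theorem for `u(g)`, found by applying
the ordered monomials to the image of `1` in the quotient of the monomial space by `∑ z i · S`. -/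
theorem linearIndependent_envMonomial :
    LinearIndependent k fun a : {a : Fin n → ℕ // ∀ i, a i < p} => envMonomial p x a.1 := by
  obtain ⟨φ, hφ⟩ := exists_action_quotient (p := p) x
  have hmon : ∀ {r : ℕ} (s : Fin r → Fin n) (a : Fin r → ℕ) (f : MonomialSpace n k),
      φ (ordMonomial (fun i => RestrictedEnvelopingAlgebra.ι p k (x (s i))) a)
        (Submodule.Quotient.mk f) =
      Submodule.Quotient.mk (ordMonomial (fun i => pbwAction x (x (s i))) a f) := by
    intro r s a f
    have hpow : ∀ (i : Fin n) (r : ℕ) (f : MonomialSpace n k),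
        φ (RestrictedEnvelopingAlgebra.ι p k (x i) ^ r) (Submodule.Quotient.mk f) =
          Submodule.Quotient.mk ((pbwAction x (x i) ^ r) f) := by
      intro i r f
      induction r with
      | zero => simp
      | succ r ih =>
        rw [pow_succ', map_mul, Module.End.mul_apply, ih, hφ, pow_succ', Module.End.mul_apply]
    induction r with
    | zero => simp [ordMonomial]
    | succ r ih =>
      rw [ordMonomial_succ, ordMonomial_succ, map_mul, Module.End.mul_apply,
        ih (fun i => s i.succ), hpow, Module.End.mul_apply]
  have hvac : ∀ a : {a : Fin n → ℕ // ∀ i, a i < p},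
      φ (envMonomial p x a.1) (Submodule.Quotient.mk (Finsupp.single 0 1)) =
        Submodule.Quotient.mk (pAdicMap p x (Finsupp.single a.1 1)) := by
    intro a
    have h1 : (fun i => a.1 i % p) = a.1 := funext fun i => Nat.mod_eq_of_lt (a.2 i)
    have h2 : (fun i => a.1 i / p) = 0 := funext fun i => Nat.div_eq_of_lt (a.2 i)
    rw [pAdicMap_single, pAdicMonomial, h1, h2, ordMonomial_zero, mul_one]
    exact hmon id a.1 _
  rw [linearIndependent_iff]
  intro c hc
  set f : MonomialSpace n k := c.mapDomain Subtype.val with hf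
  have hN : pAdicMap p x f ∈ pCenterSubmodule p x := by
    have h0 : φ (Finsupp.linearCombination k (fun a : {a : Fin n → ℕ // ∀ i, a i < p} =>
        envMonomial p x a.1) c) (Submodule.Quotient.mk (Finsupp.single 0 1)) = 0 := by
      rw [hc, map_zero, LinearMap.zero_apply]
    rw [← Submodule.Quotient.mk_eq_zero, ← h0, Finsupp.linearCombination_apply, Finsupp.sum,
      map_sum, LinearMap.sum_apply, hf, Finsupp.mapDomain, Finsupp.sum, map_sum,
      ← Submodule.mkQ_apply, map_sum]
    refine Finset.sum_congr rfl fun a _ => ?_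
    rw [map_smul, LinearMap.smul_apply, hvac, ← mul_one (c a), ← smul_eq_mul,
      ← Finsupp.smul_single, map_smul, map_smul, smul_eq_mul, mul_one, Submodule.mkQ_apply]
  obtain ⟨f', hf', hff⟩ := pCenterSubmodule_le x hN
  rw [(bijective_pAdicMap (p := p) x).1 hff] at hf'
  ext a
  have h0 : f a.1 = 0 := by
    by_contra hne
    obtain ⟨i, hi⟩ := (Finsupp.mem_supported k f).mp hf' (Finsupp.mem_support_iff.mpr hne)
    exact absurd (a.2 i) (not_lt.mpr hi)
  rwa [hf, Finsupp.mapDomain_apply Subtype.val_injective] at h0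

end RestrictedPBW

/-! ### The ordered monomials span `u(g)` -/

section RestrictedPBWSpanning

attribute [local instance 100] LieRing.ofAssociativeRing

open RestrictedLieAlgebra RestrictedEnvelopingAlgebra

variable {p : ℕ} [hp : Fact p.Prime] {k : Type*} [Field k] [CharP k p]
  {g : Type*} [LieRing g] [LieAlgebra k g] [RestrictedLieAlgebra p k g]
  {n : ℕ} (x : Module.Basis (Fin n) k g)

omit hp [CharP k p] in
theorem ι_mul_envMonomial {a : Fin n → ℕ} {j : Fin n} (h : ∀ l < j, a l = 0) :
    ι p k (x j) * envMonomial p x a = envMonomial p x (Pi.single j 1 + a) :=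
  mul_ordMonomial_of_le (fun i => ι p k (x i)) h

omit hp [CharP k p] in
theorem ι_pow_mul_envMonomial {a : Fin n → ℕ} {j : Fin n} (h : ∀ l < j, a l = 0) (r : ℕ) :
    ι p k (x j) ^ r * envMonomial p x a = envMonomial p x (Pi.single j r + a) :=
  pow_mul_ordMonomial_of_le (fun i => ι p k (x i)) h r

open Classical in
variable (p) in
/-- The ordered monomial `x ^ a` in `u(g)` if all exponents are less than `p`, and `0` otherwise. -/
def truncMonomial (a : Fin n → ℕ) : RestrictedEnvelopingAlgebra p k g :=
  if ∀ i, a i < p then envMonomial p x a else 0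

variable (p) in
/-- The span of the truncated ordered monomials of degree less than `d` in `u(g)`. -/
def envDegLT (d : ℕ) : Submodule k (RestrictedEnvelopingAlgebra p k g) :=
  Submodule.span k (truncMonomial p x '' {a | expDeg a < d})

omit hp [CharP k p] in
theorem envDegLT_mono {d e : ℕ} (h : d ≤ e) : envDegLT p x d ≤ envDegLT p x e :=
  Submodule.span_mono (Set.image_mono fun _ hm => lt_of_lt_of_le hm h)

omit hp [CharP k p] in
theorem truncMonomial_mem {a : Fin n → ℕ} {d : ℕ} (h : expDeg a < d) :
    truncMonomial p x a ∈ envDegLT p x d :=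
  Submodule.subset_span ⟨a, h, rfl⟩

omit hp [CharP k p] in
theorem ι_mul_mem_envDegLT {d : ℕ}
    (H : ∀ (i : Fin n) (a : Fin n → ℕ), expDeg a < d →
      ι p k (x i) * truncMonomial p x a ∈ envDegLT p x (expDeg a + 2))
    (y : g) {e : ℕ} (he : e ≤ d) {u : RestrictedEnvelopingAlgebra p k g}
    (hu : u ∈ envDegLT p x e) : ι p k y * u ∈ envDegLT p x (e + 1) := by
  induction hu using Submodule.span_induction with
  | zero => simp
  | add u v _ _ hu hv => rw [mul_add]; exact add_mem hu hv
  | smul c u _ hu => rw [mul_smul_comm]; exact Submodule.smul_mem _ _ hu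
  | mem u hu =>
    obtain ⟨a, ha, rfl⟩ := hu
    induction x.mem_span y using Submodule.span_induction with
    | zero => simp
    | add y z _ _ hy hz => rw [map_add, add_mul]; exact add_mem hy hz
    | smul c y _ hy => rw [map_smul, smul_mul_assoc]; exact Submodule.smul_mem _ _ hy
    | mem y hy =>
      obtain ⟨i, rfl⟩ := hy
      have ha : expDeg a < e := ha
      exact envDegLT_mono x (by omega) (H i a (by omega))

omit [CharP k p] in
/-- In `u(g)`, multiplication of a truncated monomial by `x i` is the commutative multiplication up
to terms of lower degree. -/
theorem ι_mul_truncMonomial (d : ℕ) : ∀ (i : Fin n) (a : Fin n → ℕ), expDeg a < d →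
    ι p k (x i) * truncMonomial p x a - truncMonomial p x (Pi.single i 1 + a) ∈
      envDegLT p x (expDeg a + 1) := by
  induction d with
  | zero => intro i a ha; omega
  | succ d ih =>
    intro i a ha
    have IH : ∀ (y : g) {e : ℕ}, e ≤ d → ∀ {u : RestrictedEnvelopingAlgebra p k g},
        u ∈ envDegLT p x e → ι p k y * u ∈ envDegLT p x (e + 1) := by
      intro y e he u hu
      refine ι_mul_mem_envDegLT x (fun i a ha => ?_) y he hu
      have h1 := ih i a ha
      rw [← sub_add_cancel (ι p k (x i) * truncMonomial p x a)
        (truncMonomial p x (Pi.single i 1 + a))]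
      exact add_mem (envDegLT_mono x (by omega) h1)
        (truncMonomial_mem x (by rw [expDeg_add, expDeg_single]; omega))
    by_cases hG : ∀ l, a l < p
    swap
    · have hG' : ¬ ∀ l, (Pi.single i 1 + a : Fin n → ℕ) l < p := fun h => hG fun l =>
        lt_of_le_of_lt (by simp) (h l)
      rw [truncMonomial, truncMonomial, if_neg hG, if_neg hG', mul_zero, sub_zero]
      exact zero_mem _
    by_cases hfirst : ∀ l < i, a l = 0
    · rw [truncMonomial, if_pos hG, ι_mul_envMonomial x hfirst]
      by_cases hai : a i + 1 < p
      · have hG' : ∀ l, (Pi.single i 1 + a : Fin n → ℕ) l < p := by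
          intro l
          by_cases hl : l = i
          · subst hl; simp; omega
          · simpa [hl] using hG l
        rw [truncMonomial, if_pos hG', sub_self]
        exact zero_mem _
      · have hai' : a i + 1 = p := le_antisymm (hG i) (not_lt.mp hai)
        have hG' : ¬ ∀ l, (Pi.single i 1 + a : Fin n → ℕ) l < p := fun h => by
          have := h i
          simp at this
          omega
        rw [truncMonomial, if_neg hG', sub_zero]
        set b : Fin n → ℕ := Function.update a i 0 with hb
        have hab : Pi.single i 1 + a = Pi.single i p + b := by
          ext l
          by_cases hl : l = i
          · subst hl; simp [hb]; omega
          · simp [hb, hl]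
        have hdeg : expDeg a + 1 = p + expDeg b := by
          have := congrArg expDeg hab
          rw [expDeg_add, expDeg_add, expDeg_single, expDeg_single] at this
          omega
        have hbG : ∀ l, b l < p := by
          intro l
          by_cases hl : l = i
          · subst hl; simp [hb, hp.out.pos]
          · simpa [hb, hl] using hG l
        have hbf : ∀ l < i, b l = 0 := fun l hl => by simp [hb, hl.ne, hfirst l hl]
        have h2 := hp.out.two_le
        rw [hab, ← ι_pow_mul_envMonomial x hbf, ι_pow]
        have hmem : truncMonomial p x b ∈ envDegLT p x (expDeg b + 1) :=
          truncMonomial_mem x (Nat.lt_succ_self _)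
        rw [truncMonomial, if_pos hbG] at hmem
        exact envDegLT_mono x (by omega) (IH _ (by omega) hmem)
    · push Not at hfirst
      obtain ⟨l, hl, hal⟩ := hfirst
      obtain ⟨j, hjl, haj, hj⟩ := exists_first hal
      have hji : j < i := hjl.trans_lt hl
      have hdeg := expDeg_sub_single haj
      set b := a - Pi.single j 1 with hb
      have hab : Pi.single j 1 + b = a := by rw [add_comm, hb, sub_single_add haj]
      have hbf : ∀ l < j, b l = 0 := fun l hl => by simp [hb, hj l hl]
      have hbG : ∀ l, b l < p := fun l => lt_of_le_of_lt (by simp [hb]) (hG l)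
      have hmem : truncMonomial p x b ∈ envDegLT p x (expDeg b + 1) :=
        truncMonomial_mem x (Nat.lt_succ_self _)
      have hxj : truncMonomial p x a = ι p k (x j) * truncMonomial p x b := by
        rw [truncMonomial, truncMonomial, if_pos hG, if_pos hbG, ι_mul_envMonomial x hbf, hab]
      have hlead : ι p k (x j) * truncMonomial p x (Pi.single i 1 + b) =
          truncMonomial p x (Pi.single i 1 + a) := by
        have hf : ∀ l < j, (Pi.single i 1 + b : Fin n → ℕ) l = 0 := fun l hl => by
          simp [hbf l hl, (hl.trans hji).ne]
        have hsum : Pi.single j 1 + (Pi.single i 1 + b) = Pi.single i 1 + a := by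
          rw [add_left_comm, hab]
        by_cases hG' : ∀ l, (Pi.single i 1 + b : Fin n → ℕ) l < p
        · have hG'' : ∀ l, (Pi.single i 1 + a : Fin n → ℕ) l < p := by
            intro l
            by_cases hl : l = i
            · subst hl
              have := hG' l
              rwa [← hsum, Pi.add_apply, Pi.single_eq_of_ne hji.ne', zero_add]
            · simpa [hl] using hG l
          rw [truncMonomial, truncMonomial, if_pos hG', if_pos hG'', ι_mul_envMonomial x hf,
            hsum]
        · have hG'' : ¬ ∀ l, (Pi.single i 1 + a : Fin n → ℕ) l < p := fun h => hG' fun l =>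
            lt_of_le_of_lt (by rw [← hsum]; simp) (h l)
          rw [truncMonomial, truncMonomial, if_neg hG', if_neg hG'', mul_zero]
      have hcomm : ι p k (x i) * ι p k (x j) = ι p k (x j) * ι p k (x i) + ι p k ⁅x i, x j⁆ := by
        rw [LieHom.map_lie, LieRing.of_associative_ring_bracket]
        abel
      have hrw : ι p k (x i) * truncMonomial p x a - truncMonomial p x (Pi.single i 1 + a) =
          ι p k (x j) * (ι p k (x i) * truncMonomial p x b -
            truncMonomial p x (Pi.single i 1 + b)) + ι p k ⁅x i, x j⁆ * truncMonomial p x b := by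
        rw [hxj, ← mul_assoc, hcomm, ← hlead]
        noncomm_ring
      rw [hrw]
      refine add_mem (envDegLT_mono x (by omega) (IH _ (by omega) (ih i b (by omega))))
        (envDegLT_mono x (by omega) (IH _ (by omega) hmem))

omit [CharP k p] in
theorem span_truncMonomial : Submodule.span k (Set.range (truncMonomial p x)) = ⊤ := by
  set W := Submodule.span k (Set.range (truncMonomial p x)) with hW
  have hle : ∀ d, envDegLT p x d ≤ W := fun d => Submodule.span_mono (Set.image_subset_range _ _)
  have hmul : ∀ (y : g), ∀ u ∈ W, ι p k y * u ∈ W := by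
    intro y u hu
    induction hu using Submodule.span_induction with
    | zero => simp
    | add u v _ _ hu hv => rw [mul_add]; exact add_mem hu hv
    | smul c u _ hu => rw [mul_smul_comm]; exact Submodule.smul_mem _ _ hu
    | mem u hu =>
      obtain ⟨a, rfl⟩ := hu
      induction x.mem_span y using Submodule.span_induction with
      | zero => simp
      | add y z _ _ hy hz => rw [map_add, add_mul]; exact add_mem hy hz
      | smul c y _ hy => rw [map_smul, smul_mul_assoc]; exact Submodule.smul_mem _ _ hy
      | mem y hy =>
        obtain ⟨i, rfl⟩ := hy
        have := hle _ (ι_mul_truncMonomial x _ i a (Nat.lt_succ_self _))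
        rw [← sub_add_cancel (ι p k (x i) * truncMonomial p x a)
          (truncMonomial p x (Pi.single i 1 + a))]
        exact add_mem this (Submodule.subset_span ⟨_, rfl⟩)
  -- `u(g)` is generated by `g`: the universal property gives a map to the subalgebra `S` generated
  -- by `g`, and its composite with the inclusion of `S` is the identity.
  let S := Algebra.adjoin k (Set.range (ι p k (g := g)))
  have hadj : S = ⊤ := by
    let f : g →ₗ⁅k⁆ S :=
      { toFun := fun y => ⟨ι p k y, Algebra.subset_adjoin ⟨y, rfl⟩⟩
        map_add' := fun y z => by ext; simp
        map_smul' := fun c y => by ext; simp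
        map_lie' := fun {y z} => by
          ext; simp [LieRing.of_associative_ring_bracket] }
    let φ := lift p k f (fun y => by ext; exact ι_pow p k y)
    have hφ : S.val.comp φ = AlgHom.id k _ := hom_ext fun y => by simp [φ, f]
    rw [eq_top_iff]
    intro u _
    have := congrArg (fun ψ => ψ u) hφ
    simp only [AlgHom.comp_apply, AlgHom.id_apply] at this
    rw [← this]
    exact (φ u).2
  have hall : ∀ u v : RestrictedEnvelopingAlgebra p k g, v ∈ W → u * v ∈ W := by
    intro u
    have hu : u ∈ S := hadj ▸ Algebra.mem_top
    induction hu using Algebra.adjoin_induction with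
    | mem u hu => obtain ⟨y, rfl⟩ := hu; exact hmul y
    | algebraMap c => intro v hv; rw [← Algebra.smul_def]; exact Submodule.smul_mem _ _ hv
    | add u u' _ _ hu hu' => intro v hv; rw [add_mul]; exact add_mem (hu v hv) (hu' v hv)
    | mul u u' _ _ hu hu' => intro v hv; rw [mul_assoc]; exact hu _ (hu' v hv)
  rw [eq_top_iff]
  intro u _
  rw [← mul_one u]
  refine hall u 1 (Submodule.subset_span ⟨0, ?_⟩)
  simp [truncMonomial, hp.out.pos, ordMonomial_zero]

variable (p) in
/-- The Poincaré–Birkhoff–Witt basis of `u(g)`. -/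
def envBasis : Module.Basis {a : Fin n → ℕ // ∀ i, a i < p} k (RestrictedEnvelopingAlgebra p k g) :=
  Module.Basis.mk (linearIndependent_envMonomial x) (by
    rw [← span_truncMonomial x, Submodule.span_le]
    rintro _ ⟨a, rfl⟩
    by_cases ha : ∀ i, a i < p
    · rw [truncMonomial, if_pos ha]
      exact Submodule.subset_span ⟨⟨a, ha⟩, rfl⟩
    · rw [truncMonomial, if_neg ha]
      exact zero_mem _)

theorem envBasis_apply (a : {a : Fin n → ℕ // ∀ i, a i < p}) :
    envBasis p x a = envMonomial p x a.1 := by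
  simp [envBasis]

end RestrictedPBWSpanning

/-! ### Cocycles on the truncated exponent vectors -/

section Combinatorics

variable {k : Type*} [Field k] {n : ℕ}

/-- A function on pairs of exponent vectors, supported on the vectors with entries less than `p`,
that satisfies the coordinate form of the cocycle condition of the cobar construction. -/
structure IsTruncCocycle (p : ℕ) (f : (Fin n → ℕ) → (Fin n → ℕ) → k) : Prop where
  left_zero : ∀ b c, (¬ ∀ i, b i < p) → f b c = 0
  right_zero : ∀ b c, (¬ ∀ i, c i < p) → f b c = 0
  cocycle : ∀ b c d : Fin n → ℕ, (∀ i, b i < p) → (∀ i, c i < p) → (∀ i, d i < p) →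
    (if b = 0 then f c d else 0) - f (b + c) d + f b (c + d) - (if d = 0 then f b c else 0) = 0

namespace IsTruncCocycle

variable {p : ℕ} {f : (Fin n → ℕ) → (Fin n → ℕ) → k}

/-- The cocycle condition for nonzero `b` and `d`. A side with an entry of at least `p` is zero. -/
theorem shift (hf : IsTruncCocycle p f) {b c d : Fin n → ℕ} (hb : ∀ i, b i < p)
    (hc : ∀ i, c i < p) (hd : ∀ i, d i < p) (hb0 : b ≠ 0) (hd0 : d ≠ 0) :
    f (b + c) d = f b (c + d) := by
  have := hf.cocycle b c d hb hc hd
  rw [if_neg hb0, if_neg hd0] at this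
  linear_combination -this

theorem zero_apply (hf : IsTruncCocycle p f) {c : Fin n → ℕ} (hc : ∀ i, c i < p) (hc0 : c ≠ 0) :
    f 0 c = 0 := by
  have h0 : ∀ i : Fin n, (0 : Fin n → ℕ) i < p := fun i => (Nat.zero_le _).trans_lt (hc i)
  have := hf.cocycle 0 0 c h0 h0 hc
  simpa [hc0] using this

theorem apply_zero (hf : IsTruncCocycle p f) {b : Fin n → ℕ} (hb : ∀ i, b i < p) (hb0 : b ≠ 0) :
    f b 0 = 0 := by
  have h0 : ∀ i : Fin n, (0 : Fin n → ℕ) i < p := fun i => (Nat.zero_le _).trans_lt (hb i)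
  have := hf.cocycle b 0 0 hb h0 h0
  simpa [hb0] using this

theorem single_ne_zero {i : Fin n} {r : ℕ} (hr : r ≠ 0) : (Pi.single i r : Fin n → ℕ) ≠ 0 := by
  simpa using hr

theorem single_lt {i : Fin n} {r : ℕ} (hr : r < p) : ∀ l, (Pi.single i r : Fin n → ℕ) l < p := by
  intro l
  by_cases h : l = i
  · subst h; simpa using hr
  · simp [h]; omega

/-- If the carries are avoided, all decompositions of an exponent vector into two nonzero ones give
the same value of the cocycle. -/
theorem apply_eq_apply_single (hp : 2 ≤ p) (hf : IsTruncCocycle p f)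
    (hsymm : ∀ i j, f (Pi.single i 1) (Pi.single j 1) = f (Pi.single j 1) (Pi.single i 1))
    {b c : Fin n → ℕ} (hb0 : b ≠ 0) (hc0 : c ≠ 0) (hbc : ∀ i, b i + c i < p) {i : Fin n}
    (hi : b i + c i ≠ 0) :
    f b c = f (Pi.single i 1) (b + c - Pi.single i 1) := by
  have hs : ∀ i : Fin n, ∀ l, (Pi.single i 1 : Fin n → ℕ) l < p := fun i => single_lt (by omega)
  have key : ∀ {b c : Fin n → ℕ}, c ≠ 0 → (∀ i, b i + c i < p) → ∀ {i}, b i ≠ 0 →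
      f b c = f (Pi.single i 1) (b + c - Pi.single i 1) := by
    intro b c hc0 hbc i hbi
    obtain ⟨b', rfl⟩ : ∃ b', b = Pi.single i 1 + b' :=
      ⟨b - Pi.single i 1, by rw [add_comm, sub_single_add hbi]⟩
    have h1 : Pi.single i 1 + b' + c - Pi.single i 1 = b' + c := by
      rw [add_assoc, add_tsub_cancel_left]
    rw [h1, hf.shift (hs i) (fun l => ?_) (fun l => ?_) (single_ne_zero one_ne_zero) hc0]
    · have := hbc l; simp only [Pi.add_apply] at this; omega
    · have := hbc l; omega
  by_cases hbi : b i = 0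
  swap
  · exact key hc0 hbc hbi
  obtain ⟨j, hj⟩ : ∃ j, b j ≠ 0 := by
    by_contra h
    push Not at h
    exact hb0 (funext h)
  have hij : i ≠ j := fun h => hj (h ▸ hbi)
  have hci : c i ≠ 0 := by omega
  rw [key hc0 hbc hj]
  obtain ⟨b', rfl⟩ : ∃ b', b = Pi.single j 1 + b' :=
    ⟨b - Pi.single j 1, by rw [add_comm, sub_single_add hj]⟩
  obtain ⟨c', rfl⟩ : ∃ c', c = Pi.single i 1 + c' :=
    ⟨c - Pi.single i 1, by rw [add_comm, sub_single_add hci]⟩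
  have h1 : Pi.single j 1 + b' + (Pi.single i 1 + c') - Pi.single j 1 =
      Pi.single i 1 + (b' + c') := by
    rw [add_assoc, add_tsub_cancel_left, add_left_comm]
  have h2 : Pi.single j 1 + b' + (Pi.single i 1 + c') - Pi.single i 1 =
      Pi.single j 1 + (b' + c') := by
    rw [add_left_comm, add_tsub_cancel_left, add_assoc]
  rw [h1, h2]
  by_cases hr : b' + c' = 0
  · rw [hr, add_zero, add_zero, hsymm]
  · have hr' : ∀ l, (b' + c') l < p := fun l => by
      have := hbc l
      simp only [Pi.add_apply] at this ⊢
      omega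
    rw [← hf.shift (hs j) (hs i) hr' (single_ne_zero one_ne_zero) hr,
      ← hf.shift (hs i) (hs j) hr' (single_ne_zero one_ne_zero) hr, add_comm]

/-- If there is a carry, then the cocycle vanishes, unless the sum is `p` times a unit vector. -/
theorem apply_eq_zero_of_carry (hp : 2 ≤ p) (hf : IsTruncCocycle p f)
    (hpow : ∀ i, f (Pi.single i 1) (Pi.single i (p - 1)) = 0)
    {b c : Fin n → ℕ} (hb : ∀ i, b i < p) (hc : ∀ i, c i < p) {i : Fin n} (hi : p ≤ b i + c i) :
    f b c = 0 := by
  have hbi := hb i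
  have hci := hc i
  have hb0 : b ≠ 0 := fun h => by simp [h] at hi; omega
  have hc0 : c ≠ 0 := fun h => by simp [h] at hi; omega
  by_cases hcs : c = Pi.single i (c i)
  swap
  · have hcd : c = Pi.single i (c i) + Function.update c i 0 := by
      ext l
      by_cases hl : l = i
      · subst hl; simp
      · simp [hl]
    have hr0 : Function.update c i 0 ≠ 0 := fun h => by
      rw [h, add_zero] at hcd
      exact hcs hcd
    have hr : ∀ l, Function.update c i 0 l < p := fun l =>
      lt_of_le_of_lt (by by_cases hl : l = i <;> simp [hl]) (hc l)
    rw [hcd, ← hf.shift hb (single_lt hci) hr hb0 hr0]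
    refine hf.left_zero _ _ fun h => ?_
    have := h i
    simp at this
    omega
  by_cases hbs : b = Pi.single i (b i)
  swap
  · have hbd : b = Function.update b i 0 + Pi.single i (b i) := by
      ext l
      by_cases hl : l = i
      · subst hl; simp
      · simp [hl]
    have hr0 : Function.update b i 0 ≠ 0 := fun h => by
      rw [h, zero_add] at hbd
      exact hbs hbd
    have hr : ∀ l, Function.update b i 0 l < p := fun l =>
      lt_of_le_of_lt (by by_cases hl : l = i <;> simp [hl]) (hb l)
    rw [hbd, hf.shift hr (single_lt hbi) hc hr0 hc0]
    refine hf.right_zero _ _ fun h => ?_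
    have := h i
    simp at this
    omega
  generalize b i = s at *
  generalize c i = r at *
  subst hbs hcs
  rcases hi.lt_or_eq with hlt | heq
  · have hr : (Pi.single i r : Fin n → ℕ) = Pi.single i (r - 1) + Pi.single i 1 := by
      rw [← Pi.single_add]; congr 1; omega
    rw [hr, ← hf.shift hb (single_lt (by omega)) (single_lt (by omega)) hb0
      (single_ne_zero one_ne_zero)]
    refine hf.left_zero _ _ fun h => ?_
    have := h i
    simp at this
    omega
  · by_cases hs1 : s = 1
    · have hr : r = p - 1 := by omega
      rw [hs1, hr, hpow]
    · have hs : (Pi.single i s : Fin n → ℕ) = Pi.single i 1 + Pi.single i (s - 1) := by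
        rw [← Pi.single_add]; congr 1; omega
      rw [hs, hf.shift (single_lt (by omega)) (single_lt (by omega)) hc
        (single_ne_zero one_ne_zero) hc0, ← Pi.single_add]
      have hsr : s - 1 + r = p - 1 := by omega
      rw [hsr, hpow]

/-- A cocycle is a coboundary if its values at the pairs `(e i, (p - 1) e i)` vanish and its values
at the pairs of unit vectors are symmetric. -/
theorem exists_coboundary (hp : 2 ≤ p) (hf : IsTruncCocycle p f)
    (hpow : ∀ i, f (Pi.single i 1) (Pi.single i (p - 1)) = 0)
    (hsymm : ∀ i j, f (Pi.single i 1) (Pi.single j 1) = f (Pi.single j 1) (Pi.single i 1)) :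
    ∃ ν : (Fin n → ℕ) → k, (∀ a, (¬ ∀ i, a i < p) → ν a = 0) ∧
      ∀ b c : Fin n → ℕ, (∀ i, b i < p) → (∀ i, c i < p) →
        f b c = (if b = 0 then ν c else 0) - ν (b + c) + (if c = 0 then ν b else 0) := by
  classical
  let ν : (Fin n → ℕ) → k := fun a =>
    if ∀ i, a i < p then
      if h : ∃ i, a i ≠ 0 then -f (Pi.single h.choose 1) (a - Pi.single h.choose 1) else f 0 0
    else 0
  refine ⟨ν, fun a ha => if_neg ha, fun b c hb hc => ?_⟩
  by_cases hb0 : b = 0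
  · by_cases hc0 : c = 0
    · have h0 : ∀ i : Fin n, (0 : Fin n → ℕ) i < p := fun i => by simp; omega
      subst hb0 hc0
      have : ν 0 = f 0 0 := by simp only [ν]; rw [if_pos h0, dif_neg (by simp)]
      simp [this]
    · subst hb0
      simp [hc0, hf.zero_apply hc hc0]
  · by_cases hc0 : c = 0
    · subst hc0
      simp [hb0, hf.apply_zero hb hb0]
    · rw [if_neg hb0, if_neg hc0, zero_sub, add_zero]
      by_cases hbc : ∀ i, (b + c) i < p
      · have hex : ∃ i, (b + c) i ≠ 0 := by
          by_contra h
          push Not at h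
          exact hb0 (funext fun i => by have := h i; simp at this; simp [this.1])
        simp only [ν]
        rw [if_pos hbc, dif_pos hex, neg_neg]
        exact hf.apply_eq_apply_single hp hsymm hb0 hc0 hbc hex.choose_spec
      · simp only [ν]
        rw [if_neg hbc, neg_zero]
        push Not at hbc
        obtain ⟨i, hi⟩ := hbc
        exact hf.apply_eq_zero_of_carry hp hpow hb hc hi

end IsTruncCocycle

end Combinatorics

/-! ### The cobar construction in coordinates -/

section Coordinates

variable {k : Type*} [Field k]

/-- The functional `φ ⊗ ψ` on `V ⊗ W`. -/
def tensorFunctional {V W : Type*} [AddCommGroup V] [Module k V] [AddCommGroup W] [Module k W]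
    (φ : V →ₗ[k] k) (ψ : W →ₗ[k] k) : V ⊗[k] W →ₗ[k] k :=
  LinearMap.mul' k k ∘ₗ TensorProduct.map φ ψ

@[simp]
theorem tensorFunctional_tmul {V W : Type*} [AddCommGroup V] [Module k V] [AddCommGroup W]
    [Module k W] (φ : V →ₗ[k] k) (ψ : W →ₗ[k] k) (v : V) (w : W) :
    tensorFunctional φ ψ (v ⊗ₜ w) = φ v * ψ w := by
  simp [tensorFunctional]

theorem coord_tensorProduct {V W ι κ : Type*} [AddCommGroup V] [Module k V]
    [AddCommGroup W] [Module k W] (v : Module.Basis ι k V) (w : Module.Basis κ k W) (i : ι)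
    (j : κ) :
    (v.tensorProduct w).coord (i, j) = tensorFunctional (v.coord i) (w.coord j) := by
  ext a b
  simp [Module.Basis.tensorProduct_repr_tmul_apply, mul_comm]

variable {H : Type*} [Ring H] [Bialgebra k H]

theorem tensorFunctional_cobarD1 {φ ψ θ : H →ₗ[k] k}
    (hθ : tensorFunctional φ ψ ∘ₗ Coalgebra.comul = θ) (u : H) :
    tensorFunctional φ ψ (cobarD1 k H u) = φ 1 * ψ u - θ u + φ u * ψ 1 := by
  simp [cobarD1, ← hθ]

theorem tensorFunctional_cobarD2 {φ ψ χ θ η : H →ₗ[k] k}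
    (hθ : tensorFunctional φ ψ ∘ₗ Coalgebra.comul = θ)
    (hη : tensorFunctional ψ χ ∘ₗ Coalgebra.comul = η) (t : H ⊗[k] H) :
    tensorFunctional φ (tensorFunctional ψ χ) (cobarD2 k H t) =
      φ 1 * tensorFunctional ψ χ t - tensorFunctional θ χ t + tensorFunctional φ η t -
        χ 1 * tensorFunctional φ ψ t := by
  have hassoc : ∀ (w : H ⊗[k] H) (v : H), tensorFunctional φ (tensorFunctional ψ χ)
      (TensorProduct.assoc k H H H (w ⊗ₜ v)) = tensorFunctional φ ψ w * χ v := by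
    intro w v
    induction w with
    | zero => simp
    | tmul a b => simp [mul_assoc]
    | add w w' hw hw' => simp only [TensorProduct.add_tmul, map_add, hw, hw', add_mul]
  induction t with
  | zero => simp
  | add s t hs ht => simp only [map_add, hs, ht]; ring
  | tmul u v =>
    simp [cobarD2, hassoc, ← hθ, ← hη]
    ring

end Coordinates

/-! ### The second cohomology of a coalgebra with a divided power basis -/

section DividedPowers

variable {k : Type*} [Field k] {n p : ℕ} {H : Type*} [Ring H] [Bialgebra k H]
  (e : Module.Basis {a : Fin n → ℕ // ∀ i, a i < p} k H)

open Classical in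
/-- The basis vector with a given exponent vector, and `0` if an exponent is not less than `p`. -/
def truncVector (a : Fin n → ℕ) : H := if h : ∀ i, a i < p then e ⟨a, h⟩ else 0

open Classical in
/-- The coordinate at a given exponent vector, and `0` if an exponent is not less than `p`. -/
def truncCoord (a : Fin n → ℕ) : H →ₗ[k] k := if h : ∀ i, a i < p then e.coord ⟨a, h⟩ else 0

theorem truncCoord_of_lt {a : Fin n → ℕ} (h : ∀ i, a i < p) : truncCoord e a = e.coord ⟨a, h⟩ :=
  dif_pos h

theorem truncCoord_of_not {a : Fin n → ℕ} (h : ¬ ∀ i, a i < p) : truncCoord e a = 0 :=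
  dif_neg h

theorem truncVector_of_lt {a : Fin n → ℕ} (h : ∀ i, a i < p) : truncVector e a = e ⟨a, h⟩ :=
  dif_pos h

theorem truncCoord_truncVector {a b : Fin n → ℕ} (ha : ∀ i, a i < p) :
    truncCoord e b (truncVector e a) = if a = b then 1 else 0 := by
  classical
  rw [truncVector_of_lt e ha]
  by_cases hb : ∀ i, b i < p
  · rw [truncCoord_of_lt e hb]
    simp [Finsupp.single_apply]
  · rw [truncCoord_of_not e hb, if_neg (by rintro rfl; exact hb ha), LinearMap.zero_apply]

/-- The basis `e` behaves like the basis of divided power monomials `x ^ a / a!`: `e 0 = 1`, and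
`Δ (e a)` is the sum of all `e b ⊗ e c` with `b + c = a`. The latter is expressed in the dual
basis. -/
structure IsDividedPowerBasis : Prop where
  one : truncVector e 0 = 1
  comul : ∀ b c : Fin n → ℕ, (∀ i, b i < p) → (∀ i, c i < p) →
    tensorFunctional (truncCoord e b) (truncCoord e c) ∘ₗ Coalgebra.comul = truncCoord e (b + c)

/-- The coordinates of a 2-cochain. -/
def cochainCoord (b c : Fin n → ℕ) : H ⊗[k] H →ₗ[k] k :=
  tensorFunctional (truncCoord e b) (truncCoord e c)

theorem cochainCoord_of_not_left {b : Fin n → ℕ} (c : Fin n → ℕ) (h : ¬ ∀ i, b i < p) :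
    cochainCoord e b c = 0 := by
  ext; simp [cochainCoord, truncCoord_of_not e h]

theorem cochainCoord_of_not_right (b : Fin n → ℕ) {c : Fin n → ℕ} (h : ¬ ∀ i, c i < p) :
    cochainCoord e b c = 0 := by
  ext; simp [cochainCoord, truncCoord_of_not e h]

theorem ext_cochainCoord {s t : H ⊗[k] H}
    (h : ∀ b c : Fin n → ℕ, (∀ i, b i < p) → (∀ i, c i < p) →
      cochainCoord e b c s = cochainCoord e b c t) : s = t := by
  refine (e.tensorProduct e).ext_elem fun ⟨b, c⟩ => ?_
  have := h b.1 c.1 b.2 c.2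
  rwa [cochainCoord, truncCoord_of_lt e b.2, truncCoord_of_lt e c.2, ← coord_tensorProduct] at this

variable {e}

namespace IsDividedPowerBasis

theorem truncCoord_one (he : IsDividedPowerBasis e) (hp : 0 < p) (b : Fin n → ℕ) :
    truncCoord e b 1 = if b = 0 then 1 else 0 := by
  rw [← he.one, truncCoord_truncVector e (fun i => by simpa using hp)]
  exact if_congr eq_comm rfl rfl

theorem cochainCoord_cobarD1 (he : IsDividedPowerBasis e) (hp : 0 < p) {b c : Fin n → ℕ}
    (hb : ∀ i, b i < p) (hc : ∀ i, c i < p) (u : H) :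
    cochainCoord e b c (cobarD1 k H u) =
      (if b = 0 then truncCoord e c u else 0) - truncCoord e (b + c) u +
        (if c = 0 then truncCoord e b u else 0) := by
  rw [cochainCoord, tensorFunctional_cobarD1 (he.comul b c hb hc), he.truncCoord_one hp,
    he.truncCoord_one hp]
  simp

theorem cochainCoord_cobarD2 (he : IsDividedPowerBasis e) (hp : 0 < p) {b c d : Fin n → ℕ}
    (hb : ∀ i, b i < p) (hc : ∀ i, c i < p) (hd : ∀ i, d i < p) (t : H ⊗[k] H) :
    tensorFunctional (truncCoord e b) (cochainCoord e c d) (cobarD2 k H t) =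
      (if b = 0 then cochainCoord e c d t else 0) - cochainCoord e (b + c) d t +
        cochainCoord e b (c + d) t - (if d = 0 then cochainCoord e b c t else 0) := by
  rw [cochainCoord, tensorFunctional_cobarD2 (he.comul b c hb hc) (he.comul c d hc hd),
    he.truncCoord_one hp, he.truncCoord_one hp]
  simp [cochainCoord]

theorem cobarD2_eq_zero_iff (he : IsDividedPowerBasis e) (hp : 0 < p) (t : H ⊗[k] H) :
    cobarD2 k H t = 0 ↔ IsTruncCocycle p fun b c => cochainCoord e b c t := by
  constructor
  · intro h
    refine ⟨fun b c hb => by simp [cochainCoord_of_not_left e c hb],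
      fun b c hc => by simp [cochainCoord_of_not_right e b hc], fun b c d hb hc hd => ?_⟩
    rw [← he.cochainCoord_cobarD2 hp hb hc hd, h, map_zero]
  · intro h
    refine (e.tensorProduct (e.tensorProduct e)).ext_elem fun ⟨b, c, d⟩ => ?_
    have := he.cochainCoord_cobarD2 hp b.2 c.2 d.2 t
    rw [h.cocycle _ _ _ b.2 c.2 d.2, cochainCoord, truncCoord_of_lt e b.2, truncCoord_of_lt e c.2,
      truncCoord_of_lt e d.2, ← coord_tensorProduct, ← coord_tensorProduct] at this
    rw [map_zero]
    exact this

variable (e) in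
/-- The functionals on 2-cochains that detect cohomology classes: the coordinate at
`(e i, (p - 1) e i)` for each `i`, and the difference of the coordinates at `(e i, e j)` and
`(e j, e i)` for `i < j`. -/
def classFunctional : Fin n ⊕ {q : Fin n × Fin n // q.1 < q.2} → (H ⊗[k] H →ₗ[k] k)
  | Sum.inl i => cochainCoord e (Pi.single i 1) (Pi.single i (p - 1))
  | Sum.inr q => cochainCoord e (Pi.single q.1.1 1) (Pi.single q.1.2 1) -
      cochainCoord e (Pi.single q.1.2 1) (Pi.single q.1.1 1)

theorem classFunctional_cobarD1 (he : IsDividedPowerBasis e) (hp : 2 ≤ p)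
    (s : Fin n ⊕ {q : Fin n × Fin n // q.1 < q.2}) (u : H) :
    classFunctional e s (cobarD1 k H u) = 0 := by
  have hs : ∀ i : Fin n, ∀ l, (Pi.single i 1 : Fin n → ℕ) l < p := fun i =>
    IsTruncCocycle.single_lt (by omega)
  have h0 : ∀ (i : Fin n) {r : ℕ}, r ≠ 0 → (Pi.single i r : Fin n → ℕ) ≠ 0 := fun i _ hr =>
    IsTruncCocycle.single_ne_zero hr
  rcases s with i | q
  · rw [classFunctional, he.cochainCoord_cobarD1 (by omega) (hs i)
      (IsTruncCocycle.single_lt (by omega)), if_neg (h0 i one_ne_zero), if_neg (h0 i (by omega)),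
      ← Pi.single_add, truncCoord_of_not]
    · simp
    · intro h
      have := h i
      simp at this
      omega
  · rw [classFunctional, LinearMap.sub_apply, he.cochainCoord_cobarD1 (by omega) (hs _) (hs _),
      he.cochainCoord_cobarD1 (by omega) (hs _) (hs _), if_neg (h0 _ one_ne_zero),
      if_neg (h0 _ one_ne_zero),
      add_comm (Pi.single q.1.1 1)]
    ring

/-- A 2-cocycle on which all the class functionals vanish is a coboundary. -/
theorem mem_range_cobarD1 (he : IsDividedPowerBasis e) (hp : 2 ≤ p) {t : H ⊗[k] H}
    (ht : cobarD2 k H t = 0) (h : ∀ s, classFunctional e s t = 0) :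
    t ∈ LinearMap.range (cobarD1 k H) := by
  have hf := (he.cobarD2_eq_zero_iff (by omega) t).mp ht
  have hsymm : ∀ i j : Fin n, cochainCoord e (Pi.single i 1) (Pi.single j 1) t =
      cochainCoord e (Pi.single j 1) (Pi.single i 1) t := by
    intro i j
    rcases lt_trichotomy i j with hij | rfl | hji
    · exact sub_eq_zero.mp (h (Sum.inr ⟨(i, j), hij⟩))
    · rfl
    · exact (sub_eq_zero.mp (h (Sum.inr ⟨(j, i), hji⟩))).symm
  obtain ⟨ν, hν, hfν⟩ := hf.exists_coboundary hp (fun i => h (Sum.inl i)) hsymm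
  have : Finite {a : Fin n → ℕ // ∀ i, a i < p} :=
    Finite.of_injective (β := Fin n → Fin p) (fun a i => ⟨a.1 i, a.2 i⟩) fun a b hab => by
      ext i
      exact congrArg Fin.val (congrFun hab i)
  have := Fintype.ofFinite {a : Fin n → ℕ // ∀ i, a i < p}
  set u : H := e.equivFun.symm fun a => ν a.1 with hu
  have hcoord : ∀ a, truncCoord e a u = ν a := by
    intro a
    by_cases ha : ∀ i, a i < p
    · rw [truncCoord_of_lt e ha, Module.Basis.coord_apply, hu, ← Module.Basis.equivFun_apply,
        LinearEquiv.apply_symm_apply]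
    · rw [truncCoord_of_not e ha, hν a ha, LinearMap.zero_apply]
  refine ⟨u, ext_cochainCoord e fun b c hb hc => ?_⟩
  rw [he.cochainCoord_cobarD1 (by omega) hb hc, hcoord, hcoord, hcoord, hfν b c hb hc]

/-- Cocycles on which the class functionals form an invertible diagonal matrix represent a basis of
the cohomology. -/
theorem exists_basis_cobarH2 (he : IsDividedPowerBasis e) (hp : 2 ≤ p)
    (z : Fin n ⊕ {q : Fin n × Fin n // q.1 < q.2} → H ⊗[k] H) (hz : ∀ s, cobarD2 k H (z s) = 0)
    (hdiag : ∀ s, classFunctional e s (z s) ≠ 0)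
    (hoff : ∀ s r, s ≠ r → classFunctional e s (z r) = 0) :
    ∃ b : Module.Basis (Fin n ⊕ {q : Fin n × Fin n // q.1 < q.2}) k (CobarH2 k H),
      ∀ s, b s = CobarH2.mk (z s) (hz s) := by
  classical
  have hval : ∀ (c : Fin n ⊕ {q : Fin n × Fin n // q.1 < q.2} → k) s,
      classFunctional e s (∑ r, c r • z r) = c s * classFunctional e s (z s) := by
    intro c s
    rw [map_sum, Finset.sum_eq_single s]
    · simp
    · intro r _ hr; simp [hoff s r hr.symm]
    · simp
  have hmk : ∀ c : Fin n ⊕ {q : Fin n × Fin n // q.1 < q.2} → k,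
      ∑ s, c s • CobarH2.mk (z s) (hz s) =
        Submodule.Quotient.mk (p := (LinearMap.range (cobarD1 k H)).submoduleOf (CobarZ2 k H))
          (∑ s, c s • (⟨z s, hz s⟩ : CobarZ2 k H)) := by
    intro c
    simp only [← Submodule.mkQ_apply, map_sum, map_smul]
    rfl
  have hcoe : ∀ c : Fin n ⊕ {q : Fin n × Fin n // q.1 < q.2} → k,
      ((∑ s, c s • (⟨z s, hz s⟩ : CobarZ2 k H) : CobarZ2 k H) : H ⊗[k] H) = ∑ s, c s • z s := by
    intro c; simp
  have hli : LinearIndependent k fun s => CobarH2.mk (z s) (hz s) := by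
    rw [Fintype.linearIndependent_iff]
    intro c hc s
    rw [hmk, Submodule.Quotient.mk_eq_zero, Submodule.submoduleOf, Submodule.mem_comap,
      Submodule.coe_subtype, hcoe] at hc
    obtain ⟨u, hu⟩ := hc
    have := he.classFunctional_cobarD1 hp s u
    rw [hu, hval] at this
    exact (mul_eq_zero.mp this).resolve_right (hdiag s)
  refine ⟨Module.Basis.mk hli ?_, fun s => Module.Basis.mk_apply _ _ s⟩
  rintro t -
  obtain ⟨⟨t, ht⟩, rfl⟩ := Submodule.Quotient.mk_surjective _ t
  set c : Fin n ⊕ {q : Fin n × Fin n // q.1 < q.2} → k := fun s =>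
    classFunctional e s t / classFunctional e s (z s) with hc
  have hmem : t - ∑ s, c s • z s ∈ LinearMap.range (cobarD1 k H) := by
    refine he.mem_range_cobarD1 hp ?_ fun s => ?_
    · rw [map_sub, map_sum, LinearMap.mem_ker.mp ht]
      simp [hz]
    · rw [map_sub, hval, hc, div_mul_cancel₀ _ (hdiag s), sub_self]
  have heq : (Submodule.Quotient.mk ⟨t, ht⟩ : CobarH2 k H) =
      ∑ s, c s • CobarH2.mk (z s) (hz s) := by
    rw [hmk, Submodule.Quotient.eq, Submodule.submoduleOf, Submodule.mem_comap,
      Submodule.coe_subtype]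
    simpa using hmem
  rw [heq]
  exact Submodule.sum_mem _ fun s _ => Submodule.smul_mem _ _ (Submodule.subset_span ⟨s, rfl⟩)

end IsDividedPowerBasis

variable (e) in
/-- The sum of all `e b ⊗ e c` with `b` and `c` nonzero and `b + c = p e i`, which is
`ω (x i) / (p - 1)!` for the basis of divided power monomials. -/
def carryCochain (i : Fin n) : H ⊗[k] H :=
  ∑ s ∈ Finset.Icc 1 (p - 1),
    truncVector e (Pi.single i s) ⊗ₜ truncVector e (Pi.single i (p - s))

theorem cochainCoord_carryCochain (i : Fin n) {b c : Fin n → ℕ} (hb : ∀ i, b i < p)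
    (hc : ∀ i, c i < p) :
    cochainCoord e b c (carryCochain e i) = if b + c = Pi.single i p then 1 else 0 := by
  have hterm : ∀ s ∈ Finset.Icc 1 (p - 1), cochainCoord e b c
      (truncVector e (Pi.single i s) ⊗ₜ truncVector e (Pi.single i (p - s))) =
      if Pi.single i s = b ∧ Pi.single i (p - s) = c then 1 else 0 := by
    intro s hs
    have hs := Finset.mem_Icc.mp hs
    rw [cochainCoord, tensorFunctional_tmul,
      truncCoord_truncVector e (IsTruncCocycle.single_lt (by omega)),
      truncCoord_truncVector e (IsTruncCocycle.single_lt (by omega))]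
    simp only [ite_and, ite_mul, one_mul, zero_mul]
  rw [carryCochain, map_sum, Finset.sum_congr rfl hterm]
  split_ifs with h
  · have hsingle : ∀ l, b l + c l = (Pi.single i p : Fin n → ℕ) l := fun l => congrFun h l
    have hi := hsingle i
    have hbi := hb i
    have hci := hc i
    rw [Pi.single_eq_same] at hi
    have hb' : Pi.single i (b i) = b := by
      ext l
      by_cases hl : l = i
      · subst hl; simp
      · have := hsingle l; simp [hl] at this ⊢; omega
    have hc' : Pi.single i (c i) = c := by
      ext l
      by_cases hl : l = i
      · subst hl; simp
      · have := hsingle l; simp [hl] at this ⊢; omega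
    rw [Finset.sum_eq_single (b i)]
    · rw [if_pos ⟨hb', by rw [← hc']; congr 1; omega⟩]
    · intro s _ hs
      rw [if_neg]
      rintro ⟨h1, -⟩
      rw [← h1] at hs
      simp at hs
    · intro hni
      exact absurd (Finset.mem_Icc.mpr ⟨by omega, by omega⟩) hni
  · refine Finset.sum_eq_zero fun s hs => if_neg ?_
    rintro ⟨rfl, rfl⟩
    have hs := Finset.mem_Icc.mp hs
    refine h ?_
    rw [← Pi.single_add]
    congr 1
    omega

theorem cobarD2_carryCochain (he : IsDividedPowerBasis e) (hp : 0 < p) (i : Fin n) :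
    cobarD2 k H (carryCochain e i) = 0 := by
  rw [he.cobarD2_eq_zero_iff hp]
  refine ⟨fun b c hb => by simp [cochainCoord_of_not_left e c hb],
    fun b c hc => by simp [cochainCoord_of_not_right e b hc], fun b c d hb hc hd => ?_⟩
  have hG : ∀ b c : Fin n → ℕ, b + c = Pi.single i p → (∀ l, b l < p) → c ≠ 0 := by
    rintro b c h hb rfl
    rw [add_zero] at h
    have := hb i
    rw [h] at this
    simp at this
  have hsum : ∀ b c d : Fin n → ℕ, b + c + d = Pi.single i p → d ≠ 0 → ∀ l, (b + c) l < p := by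
    intro b c d h hd l
    have hl := congrFun h l
    by_cases hli : l = i
    · subst hli
      rw [Pi.single_eq_same, Pi.add_apply] at hl
      have : d l ≠ 0 := fun h0 => hd (by
        ext j
        by_cases hj : j = l
        · rw [hj, h0]; rfl
        · have := congrFun h j
          simp [hj] at this
          simp [this])
      omega
    · rw [Pi.single_eq_of_ne hli, Pi.add_apply] at hl
      omega
  have hcoord : ∀ b c : Fin n → ℕ, cochainCoord e b c (carryCochain e i) =
      if b + c = Pi.single i p ∧ b ≠ 0 ∧ c ≠ 0 then 1 else 0 := by
    intro b c
    by_cases hb : ∀ l, b l < p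
    swap
    · rw [cochainCoord_of_not_left e c hb, LinearMap.zero_apply, if_neg]
      rintro ⟨h, -, hc0⟩
      exact hb (by simpa using hsum b 0 c (by simpa using h) hc0)
    by_cases hc : ∀ l, c l < p
    swap
    · rw [cochainCoord_of_not_right e b hc, LinearMap.zero_apply, if_neg]
      rintro ⟨h, hb0, -⟩
      exact hc (by simpa using hsum c 0 b (by simpa [add_comm] using h) hb0)
    rw [cochainCoord_carryCochain i hb hc]
    refine if_congr ⟨fun h => ⟨h, hG c b (by rwa [add_comm]) hc, hG b c h hb⟩, fun h => h.1⟩ rfl rfl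
  simp only [hcoord]
  by_cases h : b + c + d = Pi.single i p
  · have h' : b + (c + d) = Pi.single i p := by rw [← add_assoc, h]
    by_cases hb0 : b = 0
    · subst hb0
      have hd0 : d ≠ 0 := hG c d (by simpa using h) hc
      have hc0 : c ≠ 0 := hG d c (by simpa [add_comm] using h) hd
      have hcd : c + d = Pi.single i p := by simpa using h
      simp [hcd, hc0, hd0]
    · by_cases hd0 : d = 0
      · subst hd0
        have hbc : b + c = Pi.single i p := by simpa using h
        have hc0 : c ≠ 0 := hG b c hbc hb
        simp [hbc, hc0, hb0]
      · have h1 : b + c ≠ 0 := fun h0 => hb0 (by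
          ext l; have := congrFun h0 l; simp at this; simp [this.1])
        have h2 : c + d ≠ 0 := fun h0 => hd0 (by
          ext l; have := congrFun h0 l; simp at this; simp [this.2])
        simp [h, h', hb0, hd0, h1, h2]
  · have h' : ¬ b + (c + d) = Pi.single i p := by rwa [← add_assoc]
    have h1 : b = 0 → ¬ c + d = Pi.single i p := by rintro rfl; simpa using h
    have h2 : d = 0 → ¬ b + c = Pi.single i p := by rintro rfl; simpa using h
    simp only [h, h', false_and, if_false]
    split_ifs <;> simp_all

end DividedPowers

theorem cobarD2_tmul_primitive {k H : Type*} [Field k] [Ring H] [Bialgebra k H] {u v : H}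
    (hu : Coalgebra.comul (R := k) u = u ⊗ₜ 1 + 1 ⊗ₜ u)
    (hv : Coalgebra.comul (R := k) v = v ⊗ₜ 1 + 1 ⊗ₜ v) : cobarD2 k H (u ⊗ₜ v) = 0 := by
  simp [cobarD2, hu, hv, TensorProduct.add_tmul, TensorProduct.tmul_add]

/-! ### Divided powers in `u(g)` -/

section EnvelopingDividedPowers

open RestrictedEnvelopingAlgebra

theorem List.prod_ofFn_tmul {k A B : Type*} [CommSemiring k] [Semiring A] [Algebra k A]
    [Semiring B] [Algebra k B] {n : ℕ} (u : Fin n → A) (v : Fin n → B) :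
    (List.ofFn fun i => u i ⊗ₜ[k] v i).prod = (List.ofFn u).prod ⊗ₜ (List.ofFn v).prod := by
  induction n with
  | zero => simp [Algebra.TensorProduct.one_def]
  | succ n ih => simp [List.ofFn_succ, ih]

theorem List.prod_ofFn_smul {k A : Type*} [CommSemiring k] [Semiring A] [Algebra k A] {n : ℕ}
    (c : Fin n → k) (u : Fin n → A) :
    (List.ofFn fun i => c i • u i).prod = (∏ i, c i) • (List.ofFn u).prod := by
  induction n with
  | zero => simp
  | succ n ih => simp [List.ofFn_succ, ih, Fin.prod_univ_succ, smul_smul, mul_comm]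

variable {p : ℕ} [hp : Fact p.Prime] {k : Type*} [Field k] [CharP k p]

omit hp in
theorem factorial_cast_ne_zero (hp : p.Prime) {m : ℕ} (hm : m < p) : (m.factorial : k) ≠ 0 := by
  rw [Ne, CharP.cast_eq_zero_iff k p, hp.dvd_factorial]
  omega

variable {g : Type*} [LieRing g] [LieAlgebra k g] [RestrictedLieAlgebra p k g]
  {n : ℕ} (x : Module.Basis (Fin n) k g)

variable (p) in
/-- The basis of `u(g)` of divided power monomials `x ^ a / a!`. -/
def envDividedBasis :
    Module.Basis {a : Fin n → ℕ // ∀ i, a i < p} k (RestrictedEnvelopingAlgebra p k g) :=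
  (envBasis p x).isUnitSMul (w := fun a => ∏ i, ((a.1 i).factorial : k)⁻¹) fun a =>
    IsUnit.mk0 _ (Finset.prod_ne_zero_iff.mpr fun i _ =>
      inv_ne_zero (factorial_cast_ne_zero hp.out (a.2 i)))

theorem truncVector_envDividedBasis {a : Fin n → ℕ} (ha : ∀ i, a i < p) :
    truncVector (envDividedBasis p x) a =
      (List.ofFn fun i => ((a i).factorial : k)⁻¹ • ι p k (x i) ^ a i).prod := by
  rw [truncVector_of_lt _ ha, envDividedBasis, Module.Basis.isUnitSMul_apply, envBasis_apply,
    List.prod_ofFn_smul]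
  rfl

theorem comul_divided_pow (y : g) {m : ℕ} (hm : m < p) :
    comulHom p k g ((m.factorial : k)⁻¹ • ι p k y ^ m) =
      ∑ j ∈ Finset.range (m + 1), ((j.factorial : k)⁻¹ • ι p k y ^ j) ⊗ₜ
        (((m - j).factorial : k)⁻¹ • ι p k y ^ (m - j)) := by
  have hcomm : Commute (ι p k y ⊗ₜ[k] (1 : RestrictedEnvelopingAlgebra p k g))
      ((1 : RestrictedEnvelopingAlgebra p k g) ⊗ₜ[k] ι p k y) := by
    simp [Commute, SemiconjBy]
  rw [map_smul, map_pow, comulHom_ι, hcomm.add_pow, Finset.smul_sum]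
  refine Finset.sum_congr rfl fun j hj => ?_
  have hj : j ≤ m := Nat.lt_succ_iff.mp (Finset.mem_range.mp hj)
  have h1 : (m.choose j : k) * j.factorial * (m - j).factorial = m.factorial := by
    exact_mod_cast congrArg (Nat.cast (R := k)) (Nat.choose_mul_factorial_mul_factorial hj)
  have hm0 := factorial_cast_ne_zero (k := k) hp.out hm
  have hj0 := factorial_cast_ne_zero (k := k) hp.out (show j < p by omega)
  have hmj0 := factorial_cast_ne_zero (k := k) hp.out (show m - j < p by omega)
  rw [Algebra.TensorProduct.tmul_pow, Algebra.TensorProduct.tmul_pow,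
    Algebra.TensorProduct.tmul_mul_tmul, one_pow, one_pow, one_mul, mul_one, ← nsmul_eq_mul',
    ← Nat.cast_smul_eq_nsmul k, smul_smul, TensorProduct.smul_tmul_smul]
  congr 1
  rw [← h1]
  have hc0 : (m.choose j : k) ≠ 0 := fun h => hm0 (by rw [← h1, h, zero_mul, zero_mul])
  field_simp

theorem comul_envDividedBasis {a : Fin n → ℕ} (ha : ∀ i, a i < p) :
    Coalgebra.comul (R := k) (truncVector (envDividedBasis p x) a) =
      ∑ b ∈ Fintype.piFinset fun i => Finset.range (a i + 1),
        truncVector (envDividedBasis p x) b ⊗ₜ truncVector (envDividedBasis p x) (a - b) := by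
  change comulHom p k g _ = _
  rw [truncVector_envDividedBasis x ha, map_list_prod, List.map_ofFn]
  simp only [Function.comp_def, comul_divided_pow (x _) (ha _)]
  have := (MultilinearMap.mkPiAlgebraFin k n
    (RestrictedEnvelopingAlgebra p k g ⊗[k] RestrictedEnvelopingAlgebra p k g)).map_sum_finset
    (fun i j => ((j.factorial : k)⁻¹ • ι p k (x i) ^ j) ⊗ₜ[k]
        (((a i - j).factorial : k)⁻¹ • ι p k (x i) ^ (a i - j)))
    (fun i => Finset.range (a i + 1))
  simp only [MultilinearMap.mkPiAlgebraFin_apply] at this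
  rw [this]
  refine Finset.sum_congr rfl fun b hb => ?_
  have hb : ∀ i, b i ≤ a i := fun i => by
    have := Fintype.mem_piFinset.mp hb i
    simpa [Nat.lt_succ_iff] using this
  rw [List.prod_ofFn_tmul, truncVector_envDividedBasis x fun i => (hb i).trans_lt (ha i),
    truncVector_envDividedBasis x (a := a - b) fun i => (Nat.sub_le _ _).trans_lt (ha i)]
  rfl

theorem isDividedPowerBasis_envDividedBasis : IsDividedPowerBasis (envDividedBasis p x) := by
  refine ⟨?_, fun b c hb hc => ?_⟩
  · rw [truncVector_envDividedBasis x fun i => by simp [hp.out.pos]]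
    simp
  · refine (envDividedBasis p x).ext fun ⟨a, ha⟩ => ?_
    rw [← truncVector_of_lt _ ha, LinearMap.comp_apply, comul_envDividedBasis x ha, map_sum,
      truncCoord_truncVector _ ha]
    have hterm : ∀ b' ∈ Fintype.piFinset fun i => Finset.range (a i + 1),
        tensorFunctional (truncCoord (envDividedBasis p x) b) (truncCoord (envDividedBasis p x) c)
          (truncVector (envDividedBasis p x) b' ⊗ₜ truncVector (envDividedBasis p x) (a - b')) =
        if b' = b ∧ a - b' = c then 1 else 0 := by
      intro b' hb'
      have hb' : ∀ i, b' i ≤ a i := fun i => by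
        have := Fintype.mem_piFinset.mp hb' i
        simpa [Nat.lt_succ_iff] using this
      rw [tensorFunctional_tmul, truncCoord_truncVector _ fun i => (hb' i).trans_lt (ha i),
        truncCoord_truncVector _ (a := a - b') fun i => (Nat.sub_le _ _).trans_lt (ha i)]
      simp only [ite_and, ite_mul, one_mul, zero_mul]
    rw [Finset.sum_congr rfl hterm]
    split_ifs with h
    · subst h
      rw [Finset.sum_eq_single b]
      · rw [if_pos ⟨rfl, by rw [add_tsub_cancel_left]⟩]
      · intro b' _ hb'
        exact if_neg fun h => hb' h.1
      · intro hnb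
        exact absurd (Fintype.mem_piFinset.mpr fun i => by simp) hnb
    · refine Finset.sum_eq_zero fun b' hb' => if_neg ?_
      rintro ⟨rfl, rfl⟩
      refine h ?_
      ext i
      have := Fintype.mem_piFinset.mp hb' i
      simp at this ⊢
      omega

theorem truncVector_single (i : Fin n) {m : ℕ} (hm : m < p) :
    truncVector (envDividedBasis p x) (Pi.single i m) =
      (m.factorial : k)⁻¹ • ι p k (x i) ^ m := by
  rw [truncVector_envDividedBasis x (IsTruncCocycle.single_lt hm), List.prod_ofFn_smul]
  congr 1
  · rw [Finset.prod_eq_single i]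
    · simp
    · intro j _ hj; simp [hj]
    · simp
  · exact ordMonomial_single _ i m

theorem omegaElt_eq_carryCochain (i : Fin n) :
    omegaElt p k (ι p k (x i)) =
      ((p - 1).factorial : k) • carryCochain (envDividedBasis p x) i := by
  rw [omegaElt, carryCochain, Finset.smul_sum]
  refine Finset.sum_congr rfl fun s hs => ?_
  have hs := Finset.mem_Icc.mp hs
  rw [truncVector_single x i (by omega), truncVector_single x i (by omega),
    TensorProduct.smul_tmul_smul, smul_smul, div_eq_mul_inv, mul_inv]

theorem ι_eq_truncVector (i : Fin n) :
    ι p k (x i) = truncVector (envDividedBasis p x) (Pi.single i 1) := by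
  rw [truncVector_single x i hp.out.one_lt]
  simp

end EnvelopingDividedPowers

/-! ### The basis of `H²(k, u(g))` -/

theorem card_fin_sum_lt_pairs (n : ℕ) :
    Fintype.card (Fin n ⊕ {q : Fin n × Fin n // q.1 < q.2}) = n * (n + 1) / 2 := by
  have h1 : Fintype.card {q : Fin n × Fin n // q.1 < q.2} = ∑ j ∈ Finset.range n, j := by
    rw [Fintype.card_subtype, Finset.card_filter, Fintype.sum_prod_type_right,
      ← Fin.sum_univ_eq_sum_range (fun j => j)]
    refine Finset.sum_congr rfl fun j _ => ?_
    rw [← Finset.card_filter, Finset.filter_gt_eq_Iio, Fin.card_Iio]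
  rw [Fintype.card_sum, Fintype.card_fin, h1, add_comm, ← Finset.sum_range_succ,
    Finset.sum_range_id]
  simp [mul_comm]

theorem proposition6p2 (p : ℕ) [Fact p.Prime] (k : Type*) [Field k] [IsAlgClosed k] [CharP k p]
    (g : Type*) [LieRing g] [LieAlgebra k g] [RestrictedLieAlgebra p k g]
    (n : ℕ) (x : Module.Basis (Fin n) k g) :
    (∃ b : Module.Basis (Fin n ⊕ {q : Fin n × Fin n // q.1 < q.2}) k
        (CobarH2 k (RestrictedEnvelopingAlgebra p k g)),
      (∀ i : Fin n,
        ∃ h : cobarD2 k (RestrictedEnvelopingAlgebra p k g)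
            (omegaElt p k (RestrictedEnvelopingAlgebra.ι p k (x i))) = 0,
          b (Sum.inl i) = CobarH2.mk _ h) ∧
      (∀ q : {q : Fin n × Fin n // q.1 < q.2},
        ∃ h : cobarD2 k (RestrictedEnvelopingAlgebra p k g)
            (RestrictedEnvelopingAlgebra.ι p k (x q.1.1) ⊗ₜ[k]
              RestrictedEnvelopingAlgebra.ι p k (x q.1.2)) = 0,
          b (Sum.inr q) = CobarH2.mk _ h)) ∧
    Module.finrank k (CobarH2 k (RestrictedEnvelopingAlgebra p k g)) = n * (n + 1) / 2 := by
  have hp : p.Prime := Fact.out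
  have hp2 := hp.two_le
  have he := isDividedPowerBasis_envDividedBasis (p := p) x
  have hfac : ((p - 1).factorial : k) ≠ 0 :=
    factorial_cast_ne_zero hp (Nat.sub_lt hp.pos one_pos)
  have hs : ∀ i : Fin n, ∀ l, (Pi.single i 1 : Fin n → ℕ) l < p := fun i =>
    IsTruncCocycle.single_lt (by omega)
  have hinj : ∀ {i j : Fin n} {r s : ℕ}, r ≠ 0 →
      (Pi.single i r : Fin n → ℕ) = Pi.single j s → i = j := by
    intro i j r s hr h
    by_contra hij
    have := congrFun h i
    rw [Pi.single_eq_same, Pi.single_eq_of_ne hij] at this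
    exact hr this
  have hadd : ∀ {i j l : Fin n}, i ≠ j →
      (Pi.single i 1 + Pi.single j 1 : Fin n → ℕ) ≠ Pi.single l p := by
    intro i j l hij h
    have hi := congrFun h i
    have hj := congrFun h j
    rw [Pi.add_apply, Pi.single_eq_same, Pi.single_eq_of_ne hij] at hi
    rw [Pi.add_apply, Pi.single_eq_same, Pi.single_eq_of_ne hij.symm] at hj
    by_cases hil : i = l
    · subst hil
      rw [Pi.single_eq_of_ne hij.symm] at hj
      omega
    · rw [Pi.single_eq_of_ne hil] at hi
      omega
  let z : Fin n ⊕ {q : Fin n × Fin n // q.1 < q.2} →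
      RestrictedEnvelopingAlgebra p k g ⊗[k] RestrictedEnvelopingAlgebra p k g :=
    Sum.elim (fun i => omegaElt p k (RestrictedEnvelopingAlgebra.ι p k (x i)))
      fun q => RestrictedEnvelopingAlgebra.ι p k (x q.1.1) ⊗ₜ[k]
        RestrictedEnvelopingAlgebra.ι p k (x q.1.2)
  have hz : ∀ s, cobarD2 k (RestrictedEnvelopingAlgebra p k g) (z s) = 0 := by
    rintro (i | q)
    · simp only [z, Sum.elim_inl]
      rw [omegaElt_eq_carryCochain, map_smul, cobarD2_carryCochain he hp.pos, smul_zero]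
    · exact cobarD2_tmul_primitive (RestrictedEnvelopingAlgebra.comul_ι p k _)
        (RestrictedEnvelopingAlgebra.comul_ι p k _)
  have hω : ∀ (i : Fin n) {b c : Fin n → ℕ}, (∀ l, b l < p) → (∀ l, c l < p) →
      cochainCoord (envDividedBasis p x) b c (z (Sum.inl i)) =
        if b + c = Pi.single i p then ((p - 1).factorial : k) else 0 := by
    intro i b c hb hc
    simp only [z, Sum.elim_inl]
    rw [omegaElt_eq_carryCochain, map_smul, cochainCoord_carryCochain i hb hc]
    simp
  have htmul : ∀ (q : {q : Fin n × Fin n // q.1 < q.2}) (b c : Fin n → ℕ),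
      cochainCoord (envDividedBasis p x) b c (z (Sum.inr q)) =
        if Pi.single q.1.1 1 = b ∧ Pi.single q.1.2 1 = c then 1 else 0 := by
    intro q b c
    simp only [z, Sum.elim_inr]
    rw [ι_eq_truncVector, ι_eq_truncVector, cochainCoord, tensorFunctional_tmul,
      truncCoord_truncVector _ (hs _), truncCoord_truncVector _ (hs _)]
    simp only [ite_and, ite_mul, one_mul, zero_mul]
  obtain ⟨b, hb⟩ := he.exists_basis_cobarH2 hp2 z hz (by
      rintro (i | q)
      · rw [IsDividedPowerBasis.classFunctional, hω i (hs i)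
          (IsTruncCocycle.single_lt (by omega)), ← Pi.single_add, Nat.add_sub_cancel' (by omega),
          if_pos rfl]
        exact hfac
      · rw [IsDividedPowerBasis.classFunctional, LinearMap.sub_apply, htmul, htmul,
          if_pos ⟨rfl, rfl⟩, if_neg (fun h => q.2.ne (hinj one_ne_zero h.1)), sub_zero]
        exact one_ne_zero) (by
      rintro (i | q) (j | r) hne
      · rw [IsDividedPowerBasis.classFunctional, hω j (hs i)
          (IsTruncCocycle.single_lt (by omega)), ← Pi.single_add, Nat.add_sub_cancel' (by omega),
          if_neg]
        exact fun h => hne (congrArg Sum.inl (hinj hp.ne_zero h))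
      · rw [IsDividedPowerBasis.classFunctional, htmul, if_neg]
        exact fun h => r.2.ne ((hinj one_ne_zero h.1).trans (hinj one_ne_zero h.2).symm)
      · rw [IsDividedPowerBasis.classFunctional, LinearMap.sub_apply, hω j (hs _) (hs _),
          hω j (hs _) (hs _), if_neg (hadd q.2.ne), if_neg (hadd q.2.ne'), sub_zero]
      · rw [IsDividedPowerBasis.classFunctional, LinearMap.sub_apply, htmul, htmul, if_neg,
          if_neg, sub_zero]
        · rintro ⟨h1, h2⟩
          have h1 := hinj one_ne_zero h1
          have h2 := hinj one_ne_zero h2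
          exact absurd (h1 ▸ h2 ▸ r.2) (not_lt.mpr q.2.le)
        · rintro ⟨h1, h2⟩
          exact hne (congrArg Sum.inr (Subtype.ext (Prod.ext (hinj one_ne_zero h1).symm
            (hinj one_ne_zero h2).symm))))
  refine ⟨⟨b, fun i => ⟨hz (Sum.inl i), hb _⟩, fun q => ⟨hz (Sum.inr q), hb _⟩⟩, ?_⟩
  rw [Module.finrank_eq_card_basis b, card_fin_sum_lt_pairs]

end
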